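/- Cubes are cubes in $\mathbb R^n$ ($n\ge 1$) with sides parallel to the axes, $Mf(x)=\sup_{Q\ni x}\frac1{|Q|}\int_Q|f|$ is the Hardy--Littlewood maximal function, a weight is a measurable, a.e. positive, locally integrable function, and a weight $u$ is in $A_1$ if $Mu\le Cu$ a.e. for some finite $C$, the least such $C$ being $[u]_{A_1}$. For a weight function $w$ and $p\ge 1$ let $\|f\|_{L^{p,1}(w)}=p\int_0^\infty w(\{|f|>t\})^{1/p}\,dt$. For $u_0\in A_1$ put $L_{u_0}f=M(u_0f)/u_0$. Let $n\ge 1$, $N\ge 0$, $\alpha_1,\dots,\alpha_N>0$ and $s\ge 1$. There are constants $c,C>0$, depending only on $n$, $s$, $N$ and $\alpha_1,\dots,\alpha_N$, such that the following holds. Let $u_0\in A_1$, let $h_1,\dots,h_N\in L^1_{loc}(\mathbb R^n)$ be not a.e. zero with $Mh_j<\infty$ a.e., and put $\nu=\prod_{j=1}^N (Mh_j)^{-\alpha_j}$. Then there are $p_0>1$ and $K_0>0$ with $$c\,[u_0]_{A_1}\le p_0\le C\,[u_0]_{A_1},\qquad c\,[u_0]_{A_1}^2\le K_0\le C\,[u_0]_{A_1}^2,$$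 such that for every $p\ge p_0$ and every measurable $f$ $$\|L_{u_0}f\|_{L^{p,1}(u_0\nu^s)}\le K_0\,\|f\|_{L^{p,1}(u_0\nu^s)},$$ and such that, for $R_{u_0}h=\sum_{k=0}^\infty \frac{L_{u_0}^kh}{2^kK_0^k}$ with $h\ge 0$ measurable, 1. $h\le R_{u_0}h$; 2. if $h$ is not a.e. zero and $h\in L^{p,1}(u_0\nu^s)$ for some $p\ge p_0$, then $u_0R_{u_0}h\in A_1$ and $[u_0R_{u_0}h]_{A_1}\le 2K_0$; 3. $\|R_{u_0}h\|_{L^{p,1}(u_0\nu^s)}\le 2\,\|h\|_{L^{p,1}(u_0\nu^s)}$ for every $p\ge p_0$. -/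

import Mathlib

open MeasureTheory Filter
open scoped ENNReal

noncomputable section

namespace RestrictedWeights

/-- The uncentred Hardy–Littlewood maximal function of a `[0, ∞]`-valued function on `ℝⁿ`.
`Fin n → ℝ` carries the sup norm, so `Metric.closedBall c r` is the closed cube with sides
parallel to the axes, centre `c` and side length `2 r`.  For a signed `f` apply it to `|f|`. -/
def maximal {n : ℕ} (f : (Fin n → ℝ) → ℝ≥0∞) (x : Fin n → ℝ) : ℝ≥0∞ :=
  ⨆ (c : Fin n → ℝ) (r : ℝ) (_ : 0 < r) (_ : x ∈ Metric.closedBall c r),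
    (∫⁻ y in Metric.closedBall c r, f y) / volume (Metric.closedBall c r)

/-- A weight: measurable, positive almost everywhere and locally integrable
(so also finite almost everywhere). -/
structure IsWeight {n : ℕ} (w : (Fin n → ℝ) → ℝ≥0∞) : Prop where
  aemeasurable : AEMeasurable w
  pos : ∀ᵐ x, 0 < w x
  locallyIntegrable : ∀ K : Set (Fin n → ℝ), IsCompact K → ∫⁻ x in K, w x < ∞

/-- `[w]_{A₁}`: the least `C` with `M w ≤ C w` almost everywhere. -/
def a1Const {n : ℕ} (w : (Fin n → ℝ) → ℝ≥0∞) : ℝ≥0∞ :=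
  sInf {C : ℝ≥0∞ | ∀ᵐ x, maximal w x ≤ C * w x}

/-- The Muckenhoupt class `A₁`. -/
def IsA1 {n : ℕ} (w : (Fin n → ℝ) → ℝ≥0∞) : Prop :=
  IsWeight w ∧ a1Const w < ∞

/-- `∏ⱼ (M hⱼ)^(-αⱼ)`. -/
def maximalProduct {n N : ℕ} (h : Fin N → (Fin n → ℝ) → ℝ) (α : Fin N → ℝ)
    (x : Fin n → ℝ) : ℝ≥0∞ :=
  ∏ j, maximal (fun y => ‖h j y‖ₑ) x ^ (-α j)

/-- The norm of `L^{p,1}(w)`, `∫₀^∞ t^{1/p} f*(t) dt/t = p ∫₀^∞ w({f > t})^{1/p} dt`. -/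
def lorentzNorm {n : ℕ} (p : ℝ) (w f : (Fin n → ℝ) → ℝ≥0∞) : ℝ≥0∞ :=
  ENNReal.ofReal p *
    ∫⁻ t in Set.Ioi (0 : ℝ), (volume.withDensity w {x | ENNReal.ofReal t < f x}) ^ (1 / p)

/-- `L_u f = M (u f) / u`.  It depends on `|f|` only, so it is defined on `[0, ∞]`-valued
functions. -/
def opL {n : ℕ} (u f : (Fin n → ℝ) → ℝ≥0∞) (x : Fin n → ℝ) : ℝ≥0∞ :=
  maximal (fun y => u y * f y) x / u x

/-- `R_u h = ∑ₖ L_u^k h / (2^k K^k)`. -/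
def opR {n : ℕ} (u : (Fin n → ℝ) → ℝ≥0∞) (K : ℝ) (h : (Fin n → ℝ) → ℝ≥0∞)
    (x : Fin n → ℝ) : ℝ≥0∞ :=
  ∑' k : ℕ, (opL u)^[k] h x / ENNReal.ofReal (2 ^ k * K ^ k)

end RestrictedWeights

end

namespace RestrictedWeights

variable {n : ℕ}

/-! ### The maximal function -/

/-! Write `μ = u dx` with `u ∈ A₁`, and let `A = 2 [u]_{A₁}`. The operator `L_u` is bounded by `A`
on `L^∞`, so a weak type `(q, q)` inequality with respect to `u ν^s dx` and interpolation suffice.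
What must be tracked is the dependence on `A`.

The engine is `exists_measure_lt_maximal_le`: each time the level is multiplied by a dimensional
constant, the `μ`-mass of a level set of a maximal function drops by a factor `1 - θ / A`. Summing
over levels, `(M h)^δ` is an `A₁` weight relative to `μ` once `δ ≤ δ₀ / A`, with constant of order
`A²` (`exists_setLIntegral_maximal_rpow_le`). Hölder's inequality extends this to products. With `q
- 1` of order `A`, the dual weight `(ν^s)^(-1/(q-1))` is such a product of small powers, so `ν^s`
satisfies an `A_q` condition relative to `μ`; a Vitali covering argument then gives the weak type
inequality (`weak_type_opL`), with a constant polynomial in `A`.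

For `p ≥ 4 q` the interpolation in `lorentzNorm_opL_le` raises the `q`-th power of the weak type
constant to the power `1 / p`, so that at most a fourth root of its excess over `A` survives, while
`L^∞` contributes the factor `A`. This leaves a norm of order `A²` for every `p ≥ 4 q`. The
properties of `R_u` follow by summing the geometrically damped iterates: `lorentzNorm_opR_le` for
the norm and `isA1_mul_opR` for the `A₁` constant. -/

lemma average_le_maximal (f : (Fin n → ℝ) → ℝ≥0∞) {x c : Fin n → ℝ} {r : ℝ} (hr : 0 < r)
    (hx : x ∈ Metric.closedBall c r) :
    (∫⁻ y in Metric.closedBall c r, f y) / volume (Metric.closedBall c r) ≤ maximal f x := by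
  unfold maximal
  exact le_iSup_of_le c (le_iSup_of_le r (le_iSup_of_le hr (le_iSup_of_le hx le_rfl)))

lemma lt_maximal_iff {f : (Fin n → ℝ) → ℝ≥0∞} {x : Fin n → ℝ} {t : ℝ≥0∞} :
    t < maximal f x ↔ ∃ (c : Fin n → ℝ) (r : ℝ), 0 < r ∧ x ∈ Metric.closedBall c r ∧
      t < (∫⁻ y in Metric.closedBall c r, f y) / volume (Metric.closedBall c r) := by
  simp only [maximal, lt_iSup_iff, exists_prop]

lemma maximal_le_iff {f : (Fin n → ℝ) → ℝ≥0∞} {x : Fin n → ℝ} {t : ℝ≥0∞} :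
    maximal f x ≤ t ↔ ∀ (c : Fin n → ℝ) (r : ℝ), 0 < r → x ∈ Metric.closedBall c r →
      (∫⁻ y in Metric.closedBall c r, f y) / volume (Metric.closedBall c r) ≤ t := by
  simp only [maximal, iSup_le_iff]

lemma volume_cube_pos (c : Fin n → ℝ) {r : ℝ} (hr : 0 < r) :
    volume (Metric.closedBall c r) ≠ 0 :=
  (Metric.measure_closedBall_pos _ _ hr).ne'

lemma volume_cube_ne_top (c : Fin n → ℝ) (r : ℝ) :
    volume (Metric.closedBall c r) ≠ ∞ :=
  measure_closedBall_lt_top.ne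

lemma volume_cube_mul (c c' : Fin n → ℝ) {k r : ℝ} (hk : 0 ≤ k) (hr : 0 ≤ r) :
    volume (Metric.closedBall c (k * r)) =
      ENNReal.ofReal (k ^ n) * volume (Metric.closedBall c' r) := by
  rw [Real.volume_pi_closedBall _ (by positivity), Real.volume_pi_closedBall _ hr,
    ← ENNReal.ofReal_mul (by positivity), Fintype.card_fin]
  congr 1
  ring

lemma setLIntegral_cube_le (f : (Fin n → ℝ) → ℝ≥0∞) {x c : Fin n → ℝ} {r : ℝ} (hr : 0 < r)
    (hx : x ∈ Metric.closedBall c r) :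
    ∫⁻ y in Metric.closedBall c r, f y ≤ maximal f x * volume (Metric.closedBall c r) := by
  rw [← ENNReal.div_le_iff (volume_cube_pos c hr) (volume_cube_ne_top c r)]
  exact average_le_maximal f hr hx

lemma maximal_mono_ae {f g : (Fin n → ℝ) → ℝ≥0∞} (h : ∀ᵐ y, f y ≤ g y) (x : Fin n → ℝ) :
    maximal f x ≤ maximal g x := by
  refine maximal_le_iff.2 fun c r hr hx => le_trans ?_ (average_le_maximal g hr hx)
  gcongr ?_ / _
  exact lintegral_mono_ae (ae_restrict_of_ae h)

/-- A closed cube whose average exceeds `t` can be enlarged slightly with the average still above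
`t`, by continuity of the volume in the radius; the larger cube is a neighbourhood of `x`. No
measurability of `f` is involved. -/
lemma isOpen_lt_maximal (f : (Fin n → ℝ) → ℝ≥0∞) (t : ℝ≥0∞) : IsOpen {x | t < maximal f x} := by
  rw [isOpen_iff_mem_nhds]
  intro x hx
  obtain ⟨c, r, hr, hxc, ht⟩ := lt_maximal_iff.1 hx
  have hcont : Tendsto (fun ρ : ℝ => (∫⁻ y in Metric.closedBall c r, f y) /
      ENNReal.ofReal ((2 * ρ) ^ n)) (nhdsWithin r (Set.Ioi r))
      (nhds ((∫⁻ y in Metric.closedBall c r, f y) / ENNReal.ofReal ((2 * r) ^ n))) := by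
    refine tendsto_nhdsWithin_of_tendsto_nhds ?_
    refine ENNReal.Tendsto.const_div ?_ (Or.inl ENNReal.ofReal_ne_top)
    refine (ENNReal.continuous_ofReal.comp (by fun_prop : Continuous fun ρ : ℝ =>
      (2 * ρ) ^ n)).tendsto r
  have hvol : ∀ ρ : ℝ, 0 ≤ ρ → volume (Metric.closedBall c ρ) = ENNReal.ofReal ((2 * ρ) ^ n) := by
    intro ρ hρ
    rw [Real.volume_pi_closedBall _ hρ, Fintype.card_fin]
  rw [hvol r hr.le] at ht
  obtain ⟨ρ, hρt, hρ⟩ := ((hcont.eventually (lt_mem_nhds ht)).and self_mem_nhdsWithin).exists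
  have hrρ : r < ρ := hρ
  have hmem : Metric.ball c ρ ∈ nhds x :=
    Metric.isOpen_ball.mem_nhds (lt_of_le_of_lt hxc hrρ)
  filter_upwards [hmem] with y hy
  refine lt_maximal_iff.2 ⟨c, ρ, hr.trans hrρ, Metric.ball_subset_closedBall hy, ?_⟩
  rw [hvol ρ (hr.trans hrρ).le]
  refine hρt.trans_le ?_
  gcongr

lemma measurable_maximal (f : (Fin n → ℝ) → ℝ≥0∞) : Measurable (maximal f) :=
  measurable_of_Ioi fun t => (isOpen_lt_maximal f t).measurableSet

lemma maximal_add_le {f g : (Fin n → ℝ) → ℝ≥0∞} (hf : AEMeasurable f) (x : Fin n → ℝ) :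
    maximal (fun y => f y + g y) x ≤ maximal f x + maximal g x := by
  refine maximal_le_iff.2 fun c r hr hx => ?_
  rw [lintegral_add_left' hf.restrict, ENNReal.add_div]
  exact add_le_add (average_le_maximal f hr hx) (average_le_maximal g hr hx)

lemma maximal_tsum_le {f : ℕ → (Fin n → ℝ) → ℝ≥0∞} (hf : ∀ k, AEMeasurable (f k))
    (x : Fin n → ℝ) : maximal (fun y => ∑' k, f k y) x ≤ ∑' k, maximal (f k) x := by
  refine maximal_le_iff.2 fun c r hr hx => ?_
  rw [lintegral_tsum fun k => (hf k).restrict, ENNReal.div_eq_inv_mul, ← ENNReal.tsum_mul_left]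
  refine ENNReal.tsum_le_tsum fun k => ?_
  rw [← ENNReal.div_eq_inv_mul]
  exact average_le_maximal (f k) hr hx

lemma maximal_const_mul_le {a : ℝ≥0∞} (ha : a ≠ ∞) (f : (Fin n → ℝ) → ℝ≥0∞) (x : Fin n → ℝ) :
    maximal (fun y => a * f y) x ≤ a * maximal f x := by
  refine maximal_le_iff.2 fun c r hr hx => ?_
  rw [lintegral_const_mul' _ _ ha, mul_div_assoc]
  gcongr
  exact average_le_maximal f hr hx

lemma maximal_pos {f : (Fin n → ℝ) → ℝ≥0∞} (hf : AEMeasurable f) (h0 : ¬ f =ᵐ[volume] 0)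
    (x : Fin n → ℝ) : 0 < maximal f x := by
  by_contra hcon
  have hx : maximal f x = 0 := by simpa using hcon
  apply h0
  have hzero : ∀ k : ℕ, ∫⁻ y in Metric.closedBall x (k + 1), f y = 0 := by
    intro k
    have := setLIntegral_cube_le f (c := x) (x := x) (r := k + 1) (by positivity)
      (Metric.mem_closedBall_self (by positivity))
    simpa [hx] using this
  have hall : ∀ᵐ y, ∀ k : ℕ, y ∈ Metric.closedBall x (k + 1) → f y = 0 := by
    rw [ae_all_iff]
    intro k
    have := (lintegral_eq_zero_iff' hf.restrict).1 (hzero k)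
    exact (ae_restrict_iff' Metric.isClosed_closedBall.measurableSet).1 this
  filter_upwards [hall] with y hy
  obtain ⟨k, hk⟩ := exists_nat_ge (dist y x)
  exact hy k (by rw [Metric.mem_closedBall]; linarith)

/-! ### A Vitali covering estimate -/

lemma measure_le_lintegral_of_forall_radius_le {μ ρ : Measure (Fin n → ℝ)} {S : Set (Fin n → ℝ)}
    {F : (Fin n → ℝ) → ℝ≥0∞} {R : ℝ}
    (hS : ∀ x ∈ S, ∃ (c : Fin n → ℝ) (r : ℝ), 0 < r ∧ r ≤ R ∧ x ∈ Metric.closedBall c r ∧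
      μ (Metric.closedBall c (5 * r)) ≤ ∫⁻ y in Metric.closedBall c r, F y ∂ρ) :
    μ S ≤ ∫⁻ y, F y ∂ρ := by
  choose! c r hr hrR hxc hμ using hS
  obtain ⟨v, hvS, hdisj, hcov⟩ := Vitali.exists_disjoint_subfamily_covering_enlargement_closedBall
    S c r R hrR 5 (by norm_num)
  have hvc : v.Countable := hdisj.countable_of_nonempty_interior fun a ha => by
    refine ⟨c a, ?_⟩
    rw [mem_interior_iff_mem_nhds]
    exact Metric.closedBall_mem_nhds _ (hr a (hvS ha))
  calc μ S ≤ μ (⋃ a ∈ v, Metric.closedBall (c a) (5 * r a)) := by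
        refine measure_mono fun x hx => ?_
        obtain ⟨b, hb, hsub⟩ := hcov x hx
        exact Set.mem_biUnion hb (hsub (hxc x hx))
    _ ≤ ∑' a : v, μ (Metric.closedBall (c a) (5 * r a)) := measure_biUnion_le μ hvc _
    _ ≤ ∑' a : v, ∫⁻ y in Metric.closedBall (c a) (r a), F y ∂ρ :=
        ENNReal.tsum_le_tsum fun a => hμ a (hvS a.2)
    _ = ∫⁻ y in ⋃ a ∈ v, Metric.closedBall (c a) (r a), F y ∂ρ :=
        (lintegral_biUnion hvc (fun _ _ => Metric.isClosed_closedBall.measurableSet) hdisj _).symm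
    _ ≤ ∫⁻ y, F y ∂ρ := setLIntegral_le_lintegral _ _

lemma measure_le_lintegral_of_forall_cube {μ ρ : Measure (Fin n → ℝ)} {S : Set (Fin n → ℝ)}
    {F : (Fin n → ℝ) → ℝ≥0∞}
    (hS : ∀ x ∈ S, ∃ (c : Fin n → ℝ) (r : ℝ), 0 < r ∧ x ∈ Metric.closedBall c r ∧
      μ (Metric.closedBall c (5 * r)) ≤ ∫⁻ y in Metric.closedBall c r, F y ∂ρ) :
    μ S ≤ ∫⁻ y, F y ∂ρ := by
  let T : ℕ → Set (Fin n → ℝ) := fun k => {x | ∃ (c : Fin n → ℝ) (r : ℝ), 0 < r ∧ r ≤ (k : ℝ) ∧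
    x ∈ Metric.closedBall c r ∧
      μ (Metric.closedBall c (5 * r)) ≤ ∫⁻ y in Metric.closedBall c r, F y ∂ρ}
  have hmono : Monotone T := by
    rintro k l hkl x ⟨c, r, hr, hrk, h⟩
    exact ⟨c, r, hr, hrk.trans (by exact_mod_cast hkl), h⟩
  have hsub : S ⊆ ⋃ k, T k := by
    intro x hx
    obtain ⟨c, r, hr, h⟩ := hS x hx
    obtain ⟨k, hk⟩ := exists_nat_ge r
    exact Set.mem_iUnion.2 ⟨k, c, r, hr, hk, h⟩
  refine (measure_mono hsub).trans ?_
  rw [hmono.measure_iUnion]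
  exact iSup_le fun k => measure_le_lintegral_of_forall_radius_le fun x hx => hx

/-- The weak type `(1, 1)` inequality. -/
lemma volume_lt_maximal_le (f : (Fin n → ℝ) → ℝ≥0∞) {t : ℝ≥0∞} (ht : t ≠ 0) (ht' : t ≠ ∞) :
    volume {x | t < maximal f x} ≤ ENNReal.ofReal (5 ^ n) / t * ∫⁻ y, f y := by
  have hfin : ENNReal.ofReal (5 ^ n) / t ≠ ∞ := ENNReal.div_ne_top ENNReal.ofReal_ne_top ht
  rw [← lintegral_const_mul' _ _ hfin]
  refine measure_le_lintegral_of_forall_cube fun x hx => ?_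
  obtain ⟨c, r, hr, hxc, h⟩ := lt_maximal_iff.1 hx
  refine ⟨c, r, hr, hxc, ?_⟩
  rw [lintegral_const_mul' _ _ hfin, volume_cube_mul c c (by norm_num) hr.le, div_eq_mul_inv,
    mul_assoc]
  gcongr
  rw [← ENNReal.div_eq_inv_mul, ENNReal.le_div_iff_mul_le (Or.inl ht) (Or.inl ht'), mul_comm]
  exact ((ENNReal.lt_div_iff_mul_lt (Or.inl (volume_cube_pos c hr))
    (Or.inl (volume_cube_ne_top c r))).1 h).le

/-! ### `A₁` weights -/

section A1

variable {u : (Fin n → ℝ) → ℝ≥0∞} {A : ℝ}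

lemma IsWeight.measure_cube_ne_top (hu : IsWeight u) (c : Fin n → ℝ) (r : ℝ) :
    volume.withDensity u (Metric.closedBall c r) ≠ ∞ := by
  rw [withDensity_apply' u]
  exact (hu.locallyIntegrable _ (isCompact_closedBall c r)).ne

lemma IsWeight.measure_cube_ne_zero (hu : IsWeight u) (c : Fin n → ℝ) {r : ℝ} (hr : 0 < r) :
    volume.withDensity u (Metric.closedBall c r) ≠ 0 := by
  rw [Ne, withDensity_apply_eq_zero' hu.aemeasurable]
  intro h
  refine volume_cube_pos c hr ?_
  rw [← h]
  refine measure_congr ?_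
  filter_upwards [hu.pos] with x hx
  apply propext
  change x ∈ Metric.closedBall c r ↔ x ∈ {x | u x ≠ 0} ∩ Metric.closedBall c r
  simp [hx.ne']

lemma IsWeight.ae_lt_top (hu : IsWeight u) : ∀ᵐ x, u x < ∞ := by
  have h : ∀ᵐ x, ∀ k : ℕ, x ∈ Metric.closedBall (0 : Fin n → ℝ) k → u x < ∞ := by
    rw [ae_all_iff]
    intro k
    exact (ae_restrict_iff' Metric.isClosed_closedBall.measurableSet).1
      (ae_lt_top' hu.aemeasurable.restrict
        (hu.locallyIntegrable _ (isCompact_closedBall _ _)).ne)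
  filter_upwards [h] with x hx
  obtain ⟨k, hk⟩ := exists_nat_ge (dist x 0)
  exact hx k hk

/-- The `A₁` condition bounds the average of `u` over the cube by `A u(x)` at almost every `x` of
the cube; integrate this over `E`. Taking `E` to be the cube gives `[u]_{A₁} ≥ 1`, and a concentric
subcube gives doubling. -/
lemma volume_mul_measure_cube_le (hA : ∀ᵐ x, maximal u x ≤ ENNReal.ofReal A * u x)
    {c : Fin n → ℝ} {r : ℝ} (hr : 0 < r) {E : Set (Fin n → ℝ)} (hE : MeasurableSet E)
    (hsub : E ⊆ Metric.closedBall c r) :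
    volume E * volume.withDensity u (Metric.closedBall c r) ≤
      ENNReal.ofReal A * volume (Metric.closedBall c r) * volume.withDensity u E := by
  set Q := Metric.closedBall c r
  have hkey : ∫⁻ _ in E, volume.withDensity u Q / volume Q ≤ ∫⁻ x in E, ENNReal.ofReal A * u x := by
    refine setLIntegral_mono_ae' hE ?_
    filter_upwards [hA] with x hx hxE
    refine le_trans ?_ hx
    rw [withDensity_apply' u]
    exact average_le_maximal u hr (hsub hxE)
  rw [lintegral_const_mul' _ _ ENNReal.ofReal_ne_top, ← withDensity_apply' u, setLIntegral_const,
    mul_comm, ← mul_div_assoc, ENNReal.div_le_iff (volume_cube_pos c hr)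
    (volume_cube_ne_top c r)] at hkey
  refine hkey.trans (le_of_eq ?_)
  ring

lemma IsWeight.one_le_of_maximal_le (hu : IsWeight u) {C : ℝ≥0∞}
    (hC : ∀ᵐ x, maximal u x ≤ C * u x) : 1 ≤ C := by
  by_cases hCt : C = ∞
  · simp [hCt]
  have h := volume_mul_measure_cube_le (A := C.toReal) (by rwa [ENNReal.ofReal_toReal hCt])
    (c := 0) one_pos Metric.isClosed_closedBall.measurableSet subset_rfl
  rw [ENNReal.ofReal_toReal hCt, mul_assoc] at h
  have h0 : volume (Metric.closedBall (0 : Fin n → ℝ) 1) *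
      volume.withDensity u (Metric.closedBall 0 1) ≠ 0 :=
    mul_ne_zero (volume_cube_pos _ one_pos) (hu.measure_cube_ne_zero _ one_pos)
  have ht : volume (Metric.closedBall (0 : Fin n → ℝ) 1) *
      volume.withDensity u (Metric.closedBall 0 1) ≠ ∞ :=
    ENNReal.mul_ne_top (volume_cube_ne_top _ _) (hu.measure_cube_ne_top _ _)
  rw [← ENNReal.mul_le_mul_iff_left h0 ht, one_mul]
  exact h

lemma measure_cube_five_mul_le (hA0 : 0 ≤ A) (hA : ∀ᵐ x, maximal u x ≤ ENNReal.ofReal A * u x)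
    (c : Fin n → ℝ) {r : ℝ} (hr : 0 < r) :
    volume.withDensity u (Metric.closedBall c (5 * r)) ≤
      ENNReal.ofReal (A * 5 ^ n) * volume.withDensity u (Metric.closedBall c r) := by
  have h := volume_mul_measure_cube_le hA (c := c) (r := 5 * r) (by positivity)
    (E := Metric.closedBall c r) Metric.isClosed_closedBall.measurableSet
    (Metric.closedBall_subset_closedBall (by linarith))
  rw [volume_cube_mul c c (by norm_num) hr.le] at h
  rw [← ENNReal.mul_le_mul_iff_right (volume_cube_pos c hr) (volume_cube_ne_top c r),
    ENNReal.ofReal_mul hA0]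
  refine h.trans (le_of_eq ?_)
  ring

end A1

/-! ### Decay of the level sets of the maximal function -/

/-- Cubes of radius at least `r` meeting the given cube contain `z` after dilation by `4`, so their
averages are at most `4 ^ n * l`. Smaller ones see only `g` on the tripled cube, where its integral
is at most `3 ^ n * l` times the volume; the weak `(1, 1)` constant `5 ^ n` then explains the factor
`2 * 15 ^ n`. -/
lemma volume_cube_inter_lt_maximal_le (g : (Fin n → ℝ) → ℝ≥0∞) {l : ℝ≥0∞} (hl : l ≠ 0)
    (hl' : l ≠ ∞) {x z : Fin n → ℝ} {r : ℝ} (hr : 0 < r) (hxz : dist x z ≤ 2 * r)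
    (hz : maximal g z ≤ l) :
    volume (Metric.closedBall x r ∩ {y | ENNReal.ofReal (2 * 15 ^ n) * l < maximal g y}) ≤
      2⁻¹ * volume (Metric.closedBall x r) := by
  set D : ℝ≥0∞ := ENNReal.ofReal (2 * 15 ^ n)
  have hD0 : D ≠ 0 := by simp [D]
  have hDt : D ≠ ∞ := ENNReal.ofReal_ne_top
  set g' := (Metric.closedBall x (3 * r)).indicator g
  have hsub : Metric.closedBall x r ∩ {y | D * l < maximal g y} ⊆ {y | D * l < maximal g' y} := by
    rintro y ⟨hyx, hy⟩
    obtain ⟨c, ρ, hρ, hyc, hav⟩ := lt_maximal_iff.1 hy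
    rw [Metric.mem_closedBall] at hyx hyc
    rcases le_or_gt r ρ with hrρ | hrρ
    · exfalso
      have hzc : z ∈ Metric.closedBall c (4 * ρ) := by
        rw [Metric.mem_closedBall]
        have h1 := dist_triangle z x c
        have h2 := dist_triangle x y c
        rw [dist_comm z x] at h1
        rw [dist_comm x y] at h2
        linarith
      have h1 : ∫⁻ y in Metric.closedBall c ρ, g y ≤
          l * (ENNReal.ofReal (4 ^ n) * volume (Metric.closedBall c ρ)) := by
        rw [← volume_cube_mul c c (by norm_num) hρ.le]
        calc ∫⁻ y in Metric.closedBall c ρ, g y ≤ ∫⁻ y in Metric.closedBall c (4 * ρ), g y :=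
              lintegral_mono_set (Metric.closedBall_subset_closedBall (by linarith))
          _ ≤ maximal g z * volume (Metric.closedBall c (4 * ρ)) :=
              setLIntegral_cube_le g (by positivity) hzc
          _ ≤ _ := by gcongr
      rw [← mul_assoc, ← ENNReal.div_le_iff (volume_cube_pos c hρ) (volume_cube_ne_top c ρ)] at h1
      refine absurd (hav.trans_le h1) (not_lt.2 ?_)
      rw [mul_comm]
      gcongr
      refine ENNReal.ofReal_le_ofReal ?_
      have : (4 : ℝ) ^ n ≤ 15 ^ n := by gcongr; norm_num
      have : (0 : ℝ) < 15 ^ n := by positivity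
      linarith
    · refine lt_maximal_iff.2 ⟨c, ρ, hρ, hyc, hav.trans_le (le_of_eq ?_)⟩
      congr 1
      refine setLIntegral_congr_fun Metric.isClosed_closedBall.measurableSet fun y' hy' => ?_
      refine (Set.indicator_of_mem ?_ g).symm
      rw [Metric.mem_closedBall] at hy' ⊢
      have h1 := dist_triangle y' c x
      have h2 := dist_triangle c y x
      rw [dist_comm c y] at h2
      linarith
  refine (measure_mono hsub).trans ((volume_lt_maximal_le g' (mul_ne_zero hD0 hl)
    (ENNReal.mul_ne_top hDt hl')).trans ?_)
  have hint : ∫⁻ y, g' y ≤ l * (ENNReal.ofReal (3 ^ n) * volume (Metric.closedBall x r)) := by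
    rw [lintegral_indicator Metric.isClosed_closedBall.measurableSet,
      ← volume_cube_mul x x (by norm_num) hr.le]
    refine (setLIntegral_cube_le g (x := z) (by positivity) ?_).trans (by gcongr)
    rw [Metric.mem_closedBall, dist_comm]
    linarith
  calc ENNReal.ofReal (5 ^ n) / (D * l) * ∫⁻ y, g' y
      ≤ ENNReal.ofReal (5 ^ n) / (D * l) *
        (l * (ENNReal.ofReal (3 ^ n) * volume (Metric.closedBall x r))) := by gcongr
    _ = (ENNReal.ofReal (5 ^ n) * ENNReal.ofReal (3 ^ n) / D) * (l / l) *
        volume (Metric.closedBall x r) := by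
      simp only [div_eq_mul_inv]
      rw [ENNReal.mul_inv (Or.inl hD0) (Or.inl hDt)]
      ring
    _ = 2⁻¹ * volume (Metric.closedBall x r) := by
      rw [ENNReal.div_self hl hl', mul_one, ← ENNReal.ofReal_mul (by positivity), ← mul_pow,
        ← ENNReal.ofReal_div_of_pos (by positivity)]
      congr 1
      rw [show ((5 : ℝ) * 3) ^ n / (2 * 15 ^ n) = 2⁻¹ by
        rw [show (5 : ℝ) * 3 = 15 by norm_num]; field_simp, ENNReal.ofReal_inv_of_pos two_pos]
      simp

/-- Passing from the level `l` to the level `2 * 15 ^ n * l`, the `A₁` mass of the level sets of the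
maximal function decreases by a factor `1 - θ / A`, where `θ` depends on the dimension only. -/
lemma exists_measure_lt_maximal_le (n : ℕ) : ∃ θ : ℝ, 0 < θ ∧ θ ≤ 1 ∧
    ∀ (u : (Fin n → ℝ) → ℝ≥0∞) (A : ℝ), IsWeight u → 1 ≤ A →
      (∀ᵐ x, maximal u x ≤ ENNReal.ofReal A * u x) →
      ∀ (g : (Fin n → ℝ) → ℝ≥0∞) (l : ℝ≥0∞), l ≠ 0 → l ≠ ∞ →
        Bornology.IsBounded {x | l < maximal g x} → {x | l < maximal g x}ᶜ.Nonempty →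
        volume.withDensity u {x | ENNReal.ofReal (2 * 15 ^ n) * l < maximal g x} ≤
          ENNReal.ofReal (1 - θ / A) * volume.withDensity u {x | l < maximal g x} := by
  -- Besicovitch rather than Vitali: its overlap number is purely dimensional, whereas dilating the
  -- cubes would cost a doubling constant of `μ`, hence another factor `A` in the decay rate.
  obtain ⟨N, τ, hτ, hN⟩ := HasBesicovitchCovering.no_satelliteConfig (α := Fin n → ℝ)
  -- The covering gives `μ E ≤ 2 N A μ (E \ E')`; `N + 1` replaces `N` to keep the denominator
  -- nonzero.
  refine ⟨1 / (2 * (N + 1)), by positivity, ?_, ?_⟩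
  · rw [div_le_one (by positivity)]
    have : (0 : ℝ) ≤ N := by positivity
    linarith
  intro u A hu hA1 hA g l hl hl' hbdd hne
  set μ := volume.withDensity u with hμ
  set E := {x | l < maximal g x} with hEdef
  set E' := {x | ENNReal.ofReal (2 * 15 ^ n) * l < maximal g x} with hE'def
  have hEo : IsOpen E := isOpen_lt_maximal g l
  have hE'm : MeasurableSet E' := (isOpen_lt_maximal g _).measurableSet
  have hE'E : E' ⊆ E := by
    intro x (hx : _ < maximal g x)
    refine lt_of_le_of_lt ?_ hx
    nth_rw 1 [← one_mul l]
    gcongr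
    rw [← ENNReal.ofReal_one]
    refine ENNReal.ofReal_le_ofReal ?_
    have : (1 : ℝ) ≤ 15 ^ n := one_le_pow₀ (by norm_num)
    linarith
  have hμE : μ E ≠ ∞ := by
    obtain ⟨R, hR⟩ := hbdd.subset_closedBall 0
    exact ne_top_of_le_ne_top (hu.measure_cube_ne_top 0 R) (measure_mono hR)
  have hpos : ∀ x ∈ E, 0 < Metric.infDist x Eᶜ := fun x hx =>
    (hEo.isClosed_compl.notMem_iff_infDist_pos hne).1 (by simpa using hx)
  obtain ⟨z₀, hz₀⟩ := hne
  obtain ⟨R, hR⟩ := hbdd.subset_closedBall z₀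
  let q : Besicovitch.BallPackage E (Fin n → ℝ) :=
    { c := fun x => x
      -- Half the distance keeps each closed cube inside `E`, with a point of the complement within
      -- twice its radius, as the halving estimate requires.
      r := fun x => Metric.infDist (x : Fin n → ℝ) Eᶜ / 2
      rpos := fun x => half_pos (hpos x x.2)
      r_bound := R / 2
      r_le := fun x => by
        have h1 := Metric.infDist_le_dist_of_mem (x := (x : Fin n → ℝ)) hz₀
        have h2 := hR x.2
        rw [Metric.mem_closedBall] at h2
        linarith }
  obtain ⟨s, hs, hcov⟩ := Besicovitch.exist_disjoint_covering_families hτ hN q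
  have hball : ∀ x : E, μ (Metric.closedBall (q.c x) (q.r x)) ≤
      ENNReal.ofReal (2 * A) * μ (Metric.closedBall (q.c x) (q.r x) \ E') := by
    intro x
    obtain ⟨z, hz, hxz⟩ := hEo.isClosed_compl.exists_infDist_eq_dist ⟨z₀, hz₀⟩ (x : Fin n → ℝ)
    have hhalf := volume_cube_inter_lt_maximal_le g hl hl' (x := q.c x) (z := z) (q.rpos x)
      (by change dist (x : Fin n → ℝ) z ≤ 2 * (Metric.infDist (x : Fin n → ℝ) Eᶜ / 2)
          rw [hxz]; linarith) (by simpa [E] using hz)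
    set P := Metric.closedBall (q.c x) (q.r x)
    have hPm : MeasurableSet P := Metric.isClosed_closedBall.measurableSet
    have hP0 : volume P ≠ 0 := volume_cube_pos _ (q.rpos x)
    have hPt : volume P ≠ ∞ := volume_cube_ne_top _ _
    have hdiff : 2⁻¹ * volume P ≤ volume (P \ E') := by
      have hsum := measure_inter_add_sdiff (μ := volume) P hE'm
      have h2 : volume P = 2⁻¹ * volume P + 2⁻¹ * volume P := by
        rw [← add_mul, ENNReal.inv_two_add_inv_two, one_mul]
      have hfin : 2⁻¹ * volume P ≠ ∞ := ENNReal.mul_ne_top (by simp) hPt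
      have : 2⁻¹ * volume P + 2⁻¹ * volume P ≤ 2⁻¹ * volume P + volume (P \ E') := by
        rw [← h2, ← hsum]
        gcongr
        rw [hsum]
        exact hhalf
      exact (ENNReal.add_le_add_iff_left hfin).1 this
    have hcomp := volume_mul_measure_cube_le hA (q.rpos x) (hPm.diff hE'm) Set.sdiff_subset
    rw [← ENNReal.mul_le_mul_iff_right hP0 hPt]
    have h3 : volume P * μ P = 2 * (2⁻¹ * volume P * μ P) := by
      rw [mul_assoc, ← mul_assoc 2, ENNReal.mul_inv_cancel two_ne_zero ENNReal.ofNat_ne_top,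
        one_mul]
    calc volume P * μ P = 2 * (2⁻¹ * volume P * μ P) := h3
      _ ≤ 2 * (volume (P \ E') * μ P) := by gcongr
      _ ≤ 2 * (ENNReal.ofReal A * volume P * μ (P \ E')) := by gcongr
      _ = volume P * (ENNReal.ofReal (2 * A) * μ (P \ E')) := by
        rw [ENNReal.ofReal_mul zero_le_two, ENNReal.ofReal_ofNat]
        ring
  have hsubE : ∀ x : E, Metric.closedBall (q.c x) (q.r x) ⊆ E := by
    intro x y hy
    by_contra hyE
    have h1 : Metric.infDist (x : Fin n → ℝ) Eᶜ ≤ dist (x : Fin n → ℝ) y :=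
      Metric.infDist_le_dist_of_mem hyE
    have h2 : dist y (x : Fin n → ℝ) ≤ Metric.infDist (x : Fin n → ℝ) Eᶜ / 2 := hy
    rw [dist_comm] at h2
    have := hpos x x.2
    linarith
  have hfam : ∀ i, μ (⋃ j ∈ s i, Metric.ball (q.c j) (q.r j)) ≤
      ENNReal.ofReal (2 * A) * μ (E \ E') := by
    intro i
    have hc : (s i).Countable := (hs i).countable_of_nonempty_interior fun a _ => by
      refine ⟨q.c a, ?_⟩
      rw [mem_interior_iff_mem_nhds]
      exact Metric.closedBall_mem_nhds _ (q.rpos a)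
    calc μ (⋃ j ∈ s i, Metric.ball (q.c j) (q.r j))
        ≤ ∑' j : s i, μ (Metric.ball (q.c j) (q.r j)) := measure_biUnion_le μ hc _
      _ ≤ ∑' j : s i, ENNReal.ofReal (2 * A) *
            μ (Metric.closedBall (q.c j) (q.r j) \ E') := by
          refine ENNReal.tsum_le_tsum fun j => ?_
          exact (measure_mono Metric.ball_subset_closedBall).trans (hball j)
      _ = ENNReal.ofReal (2 * A) * μ (⋃ j ∈ s i, Metric.closedBall (q.c j) (q.r j) \ E') := by
          rw [ENNReal.tsum_mul_left, measure_biUnion hc]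
          · exact (hs i).mono fun j => Set.sdiff_subset
          · exact fun j _ => Metric.isClosed_closedBall.measurableSet.diff hE'm
      _ ≤ ENNReal.ofReal (2 * A) * μ (E \ E') := by
          gcongr
          exact Set.iUnion₂_subset fun j _ => Set.sdiff_subset_sdiff_left (hsubE j)
  have hmain : μ E ≤ N * (ENNReal.ofReal (2 * A) * μ (E \ E')) := by
    calc μ E ≤ μ (⋃ i, ⋃ j ∈ s i, Metric.ball (q.c j) (q.r j)) := by
          refine measure_mono fun x hx => hcov ⟨⟨x, hx⟩, rfl⟩
      _ ≤ ∑ i, μ (⋃ j ∈ s i, Metric.ball (q.c j) (q.r j)) := measure_iUnion_fintype_le _ _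
      _ ≤ ∑ _i : Fin N, ENNReal.ofReal (2 * A) * μ (E \ E') := Finset.sum_le_sum fun i _ => hfam i
      _ = _ := by simp
  have hE't : μ E' ≠ ∞ := ne_top_of_le_ne_top hμE (measure_mono hE'E)
  have hdt : μ (E \ E') ≠ ∞ := ne_top_of_le_ne_top hμE (measure_mono Set.sdiff_subset)
  have hsum : (μ E').toReal + (μ (E \ E')).toReal = (μ E).toReal := by
    rw [← ENNReal.toReal_add hE't hdt]
    congr 1
    rw [add_comm]
    exact measure_sdiff_add_inter E hE'm |>.symm ▸ by rw [Set.inter_eq_right.2 hE'E]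
  have hmainR : (μ E).toReal ≤ N * (2 * A * (μ (E \ E')).toReal) := by
    have := ENNReal.toReal_mono (by finiteness) hmain
    simpa [ENNReal.toReal_mul, ENNReal.toReal_ofReal (by linarith : (0 : ℝ) ≤ A)] using this
  have hApos : 0 < A := by linarith
  have hfac : 0 ≤ 1 - 1 / (2 * ((N : ℝ) + 1)) / A := by
    rw [sub_nonneg, div_div, div_le_one (by positivity)]
    have : (0 : ℝ) ≤ N * A := by positivity
    nlinarith
  rw [← ENNReal.ofReal_toReal hE't, ← ENNReal.ofReal_toReal hμE, ← ENNReal.ofReal_mul hfac]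
  refine ENNReal.ofReal_le_ofReal ?_
  set e := (μ E).toReal
  set d := (μ (E \ E')).toReal
  have hd0 : 0 ≤ d := ENNReal.toReal_nonneg
  have hle : e ≤ 2 * (N + 1) * A * d := by
    have : 0 ≤ A * d := by positivity
    nlinarith
  have : e / (2 * (N + 1) * A) ≤ d := by
    rw [div_le_iff₀ (by positivity)]
    linarith
  have heq : (1 - 1 / (2 * ((N : ℝ) + 1)) / A) * e = e - e / (2 * (N + 1) * A) := by
    field_simp
  rw [heq]
  linarith

/-! ### Small powers of maximal functions -/

/-- If `x` lies in the shell `D ^ k * l < x ≤ D ^ (k + 1) * l`, the `k`-th term alone dominates. If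
`x` exceeds every level, every term is at least the positive constant `l ^ δ` and the sum is
infinite. -/
lemma rpow_le_tsum_indicator {D l x : ℝ≥0∞} {δ : ℝ} (hD : 1 < D) (hl : l ≠ 0)
    (hlx : l < x) (hδ : 0 < δ) :
    x ^ δ ≤ ∑' k : ℕ, {t : ℝ≥0∞ | D ^ k * l < t}.indicator (fun _ => (D ^ (k + 1) * l) ^ δ) x := by
  have hltop : l ≠ ∞ := hlx.ne_top
  by_cases hall : ∀ k : ℕ, D ^ k * l < x
  · have hterm : ∀ k : ℕ, l ^ δ ≤
        {t : ℝ≥0∞ | D ^ k * l < t}.indicator (fun _ => (D ^ (k + 1) * l) ^ δ) x := by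
      intro k
      rw [Set.indicator_of_mem (by exact hall k)]
      gcongr
      nth_rw 1 [← one_mul l]
      gcongr
      exact one_le_pow₀ hD.le
    have hpos : l ^ δ ≠ 0 := (ENNReal.rpow_pos (pos_iff_ne_zero.2 hl) hltop).ne'
    calc x ^ δ ≤ ∞ := le_top
      _ = ∑' _k : ℕ, l ^ δ := (ENNReal.tsum_const_eq_top_of_ne_zero hpos).symm
      _ ≤ _ := ENNReal.tsum_le_tsum hterm
  · classical
    have hall' : ∃ k : ℕ, x ≤ D ^ k * l := by simpa using hall
    have hk := Nat.find_spec hall'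
    have hmin := fun j => Nat.find_min hall' (m := j)
    set k := Nat.find hall'
    cases hk0 : k with
    | zero =>
      rw [hk0, pow_zero, one_mul] at hk
      exact absurd hlx (not_lt.2 hk)
    | succ j =>
      rw [hk0] at hk
      have hj : D ^ j * l < x := not_le.1 (hmin j (by omega))
      refine le_trans ?_ (ENNReal.le_tsum j)
      rw [Set.indicator_of_mem (by exact hj)]
      gcongr

/-- A cube through `y` of radius at least `r` contains `z` after tripling; a smaller one lies in the
tripled cube. This localises `M h` up to a quantity comparable to `M h z`. -/
lemma maximal_le_max_of_mem_cube (h : (Fin n → ℝ) → ℝ≥0∞) {c z y : Fin n → ℝ} {r : ℝ}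
    (hz : z ∈ Metric.closedBall c r) (hy : y ∈ Metric.closedBall c r) :
    maximal h y ≤ max (maximal ((Metric.closedBall c (3 * r)).indicator h) y)
      (ENNReal.ofReal (3 ^ n) * maximal h z) := by
  refine maximal_le_iff.2 fun c' ρ hρ hyc' => ?_
  rw [Metric.mem_closedBall] at hz hy hyc'
  rcases le_or_gt r ρ with hrρ | hrρ
  · refine le_max_of_le_right ?_
    rw [ENNReal.div_le_iff (volume_cube_pos c' hρ) (volume_cube_ne_top c' ρ),
      mul_comm (ENNReal.ofReal _), mul_assoc, ← volume_cube_mul c' c' (by norm_num) hρ.le]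
    refine (lintegral_mono_set (Metric.closedBall_subset_closedBall (by linarith))).trans
      (setLIntegral_cube_le h (by positivity) ?_)
    rw [Metric.mem_closedBall]
    have h1 := dist_triangle z c c'
    have h2 := dist_triangle c y c'
    rw [dist_comm c y] at h2
    linarith
  · refine le_max_of_le_left (le_trans (le_of_eq ?_) (average_le_maximal _ hρ hyc'))
    congr 1
    refine setLIntegral_congr_fun Metric.isClosed_closedBall.measurableSet fun y' hy' => ?_
    refine (Set.indicator_of_mem ?_ h).symm
    rw [Metric.mem_closedBall] at hy' ⊢
    have h1 := dist_triangle y' c' c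
    have h2 := dist_triangle c' y c
    rw [dist_comm c' y] at h2
    linarith

/-- A cube with such a large average must have radius below `r` and meet the support of the
truncated function. The level sets of the localised maximal function are therefore bounded, as the
decay lemma demands. -/
lemma lt_maximal_indicator_subset (h : (Fin n → ℝ) → ℝ≥0∞) {c z : Fin n → ℝ} {r : ℝ}
    (hr : 0 < r) (hz : z ∈ Metric.closedBall c r) :
    {y | ENNReal.ofReal (3 ^ n) * maximal h z <
      maximal ((Metric.closedBall c (3 * r)).indicator h) y} ⊆ Metric.closedBall c (5 * r) := by
  intro y hy
  obtain ⟨c', ρ, hρ, hyc', hav⟩ := lt_maximal_iff.1 hy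
  have hint : ∫⁻ y in Metric.closedBall c' ρ, (Metric.closedBall c (3 * r)).indicator h y ≤
      maximal h z * (ENNReal.ofReal (3 ^ n) * volume (Metric.closedBall c' r)) := by
    rw [← volume_cube_mul c c' (by norm_num) hr.le]
    refine (setLIntegral_le_lintegral _ _).trans ?_
    rw [lintegral_indicator Metric.isClosed_closedBall.measurableSet]
    exact setLIntegral_cube_le h (by positivity)
      (Metric.closedBall_subset_closedBall (by linarith) hz)
  have hρr : ρ < r := by
    by_contra hcon
    refine absurd hav (not_lt.2 ?_)
    rw [ENNReal.div_le_iff (volume_cube_pos c' hρ) (volume_cube_ne_top c' ρ)]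
    refine hint.trans ?_
    rw [← mul_assoc, mul_comm (maximal h z)]
    gcongr
    exact not_lt.1 hcon
  have hne : (∫⁻ y in Metric.closedBall c' ρ, (Metric.closedBall c (3 * r)).indicator h y) ≠ 0 := by
    intro h0
    rw [h0, ENNReal.zero_div] at hav
    exact not_lt_zero hav
  obtain ⟨v, hv, hvc⟩ : ∃ v ∈ Metric.closedBall c' ρ, v ∈ Metric.closedBall c (3 * r) := by
    by_contra! hcon
    refine hne ?_
    rw [setLIntegral_congr_fun (g := fun _ => 0) Metric.isClosed_closedBall.measurableSet
      fun v hv => Set.indicator_of_notMem (hcon v hv) h]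
    simp
  rw [Metric.mem_closedBall] at *
  have h1 := dist_triangle y c' c
  have h2 := dist_triangle c' v c
  rw [dist_comm c' v] at h2
  linarith

/-- For `δ ≤ δ₀ / A` the function `(M h) ^ δ` is an `A₁` weight with respect to the measure
`u dx`, with a constant depending polynomially on `A`. -/
lemma exists_setLIntegral_maximal_rpow_le (n : ℕ) : ∃ δ₀ C : ℝ, 0 < δ₀ ∧ 1 ≤ C ∧
    ∀ (u : (Fin n → ℝ) → ℝ≥0∞) (A : ℝ), IsWeight u → 1 ≤ A →
      (∀ᵐ x, maximal u x ≤ ENNReal.ofReal A * u x) →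
      ∀ (h : (Fin n → ℝ) → ℝ≥0∞) (δ : ℝ), 0 < δ → δ ≤ δ₀ / A →
      ∀ (c z : Fin n → ℝ) (r : ℝ), 0 < r → z ∈ Metric.closedBall c r → 0 < maximal h z →
        ∫⁻ y in Metric.closedBall c r, maximal h y ^ δ ∂(volume.withDensity u) ≤
          ENNReal.ofReal (C * A ^ 2) * maximal h z ^ δ *
            volume.withDensity u (Metric.closedBall c r) := by
  obtain ⟨θ, hθ, hθ1, hdecay⟩ := exists_measure_lt_maximal_le n
  set D : ℝ := 2 * 15 ^ n with hDdef
  have hD2 : 2 ≤ D := by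
    have : (1 : ℝ) ≤ 15 ^ n := one_le_pow₀ (by norm_num)
    linarith
  have hlogD : 1 / 2 < Real.log D := by
    have h1 := Real.log_two_gt_d9
    have h2 := Real.log_le_log two_pos hD2
    linarith
  -- The choice of `δ₀` makes `D ^ δ ≤ exp x` with `x = θ / (2 A)`, half the decay rate. In the
  -- second constant, `3 ^ n` comes from localisation, `3` bounds one spare factor `D ^ δ`, `5 ^ n`
  -- is from doubling, and `2 / θ` from the geometric series.
  refine ⟨θ / (2 * Real.log D), 3 ^ n * (1 + 3 * 5 ^ n * (2 / θ)), by positivity, ?_, ?_⟩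
  · have h1 : (1 : ℝ) ≤ 3 ^ n := one_le_pow₀ (by norm_num)
    have h2 : (0 : ℝ) ≤ 3 * 5 ^ n * (2 / θ) := by positivity
    nlinarith
  intro u A hu hA1 hA h δ hδ hδA c z r hr hz hzpos
  set μ := volume.withDensity u with hμ
  set Q := Metric.closedBall c r with hQ
  have hA0 : 0 < A := by linarith
  set x : ℝ := θ / (2 * A) with hx
  have hx0 : 0 < x := by positivity
  have hx1 : x ≤ 1 / 2 := by
    rw [hx, div_le_iff₀ (by positivity)]
    linarith
  have hδx : δ * Real.log D ≤ x := by
    calc δ * Real.log D ≤ θ / (2 * Real.log D) / A * Real.log D := by gcongr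
      _ = x := by rw [hx]; field_simp
  have hDδ : D ^ δ ≤ Real.exp x := by
    rw [Real.rpow_def_of_pos (by linarith), mul_comm]
    exact Real.exp_le_exp.2 hδx
  have hDδ3 : D ^ δ ≤ 3 := by
    refine hDδ.trans ((Real.exp_le_exp.2 (by linarith : x ≤ 1)).trans ?_)
    linarith [Real.exp_one_lt_d9]
  have hδ1 : δ ≤ 1 := by nlinarith
  -- The growth of the levels consumes only half of the decay of the masses. The series of ratio `1
  -- - x` sums to `2 A / θ`; together with the doubling factor `A` this produces `A ^ 2`.
  have hratio : D ^ δ * (1 - 2 * x) ≤ 1 - x := by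
    have h1 : 1 - x ≤ Real.exp (-x) := Real.one_sub_le_exp_neg x
    have h2 : Real.exp x * Real.exp (-x) = 1 := by rw [← Real.exp_add]; simp
    have h3 : Real.exp x * (1 - x) ≤ 1 := by
      exact (mul_le_mul_of_nonneg_left h1 (Real.exp_pos x).le).trans h2.le
    calc D ^ δ * (1 - 2 * x) ≤ Real.exp x * (1 - 2 * x) := by
          gcongr
          linarith
      _ ≤ Real.exp x * ((1 - x) * (1 - x)) := by
          gcongr
          nlinarith
      _ = Real.exp x * (1 - x) * (1 - x) := by ring
      _ ≤ 1 * (1 - x) := by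
          gcongr
          linarith
      _ = 1 - x := one_mul _
  by_cases hztop : maximal h z = ∞
  · rw [hztop, ENNReal.top_rpow_of_pos hδ, ENNReal.mul_top, ENNReal.top_mul]
    · exact le_top
    · exact hu.measure_cube_ne_zero c hr
    · simp only [ne_eq, ENNReal.ofReal_eq_zero, not_le]
      positivity
  set l : ℝ≥0∞ := ENNReal.ofReal (3 ^ n) * maximal h z with hl
  have hl0 : l ≠ 0 := mul_ne_zero (by simp) hzpos.ne'
  have hlt : l ≠ ∞ := ENNReal.mul_ne_top ENNReal.ofReal_ne_top hztop
  set g := (Metric.closedBall c (3 * r)).indicator h with hg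
  set d : ℝ≥0∞ := ENNReal.ofReal D with hd
  have hd1 : 1 < d := by
    rw [hd, ← ENNReal.ofReal_one]
    exact (ENNReal.ofReal_lt_ofReal_iff (by linarith)).2 (by linarith)
  have hdt : d ≠ ∞ := ENNReal.ofReal_ne_top
  set E : ℕ → Set (Fin n → ℝ) := fun k => {y | d ^ k * l < maximal g y} with hE
  have hlk : ∀ k : ℕ, l ≤ d ^ k * l := fun k => by
    nth_rw 1 [← one_mul l]
    gcongr
    exact one_le_pow₀ hd1.le
  have hEsub : ∀ k, E k ⊆ {y | l < maximal g y} := fun k y hy => (hlk k).trans_lt hy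
  have hEball : {y | l < maximal g y} ⊆ Metric.closedBall c (5 * r) :=
    lt_maximal_indicator_subset h hr hz
  have hgh : maximal g z ≤ maximal h z :=
    maximal_mono_ae (Eventually.of_forall fun y => Set.indicator_le_self _ _ y) z
  have hzl : maximal h z ≤ l := by
    rw [hl]
    nth_rw 1 [← one_mul (maximal h z)]
    gcongr
    rw [← ENNReal.ofReal_one]
    exact ENNReal.ofReal_le_ofReal (one_le_pow₀ (by norm_num))
  have hmass : ∀ k, μ (E k) ≤
      ENNReal.ofReal (1 - 2 * x) ^ k * (ENNReal.ofReal (A * 5 ^ n) * μ Q) := by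
    intro k
    induction k with
    | zero =>
      rw [pow_zero, one_mul]
      exact (measure_mono ((hEsub 0).trans hEball)).trans (measure_cube_five_mul_le hA0.le hA c hr)
    | succ k ih =>
      have hstep := hdecay u A hu hA1 hA g (d ^ k * l)
        (mul_ne_zero (pow_ne_zero _ (by positivity)) hl0)
        (ENNReal.mul_ne_top (ENNReal.pow_ne_top hdt) hlt)
        (Metric.isBounded_closedBall.subset ((hEsub k).trans hEball))
        ⟨z, not_lt.2 ((hgh.trans hzl).trans (hlk k))⟩
      rw [← mul_assoc, ← pow_succ'] at hstep
      refine hstep.trans ?_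
      rw [show θ / A = 2 * x by rw [hx]; field_simp, pow_succ', mul_assoc]
      gcongr
  have hpoint : ∀ y ∈ Q, maximal h y ^ δ ≤
      l ^ δ + ∑' k : ℕ, (E k).indicator (fun _ => (d ^ (k + 1) * l) ^ δ) y := by
    intro y hy
    rcases le_or_gt (maximal h y) l with hyl | hyl
    · exact (ENNReal.rpow_le_rpow hyl hδ.le).trans le_self_add
    · have hmax := maximal_le_max_of_mem_cube h hz hy
      rcases le_max_iff.1 hmax with h1 | h1
      · refine (ENNReal.rpow_le_rpow h1 hδ.le).trans (le_trans ?_ le_add_self)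
        exact rpow_le_tsum_indicator hd1 hl0 (hyl.trans_le h1) hδ
      · exact absurd hyl (not_lt.2 h1)
  have hdδ : d ^ δ = ENNReal.ofReal (D ^ δ) := by
    rw [hd, ENNReal.ofReal_rpow_of_pos (by linarith)]
  have hpow : ∀ k : ℕ, (d ^ (k + 1) * l) ^ δ = l ^ δ * ENNReal.ofReal (D ^ δ) ^ (k + 1) := by
    intro k
    rw [ENNReal.mul_rpow_of_nonneg _ _ hδ.le, mul_comm, ← hdδ, ← ENNReal.rpow_natCast,
      ← ENNReal.rpow_natCast, ← ENNReal.rpow_mul, ← ENNReal.rpow_mul, mul_comm δ]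
  have hEm : ∀ k, MeasurableSet (E k) := fun k => (isOpen_lt_maximal g _).measurableSet
  have hgeom : ∑' k : ℕ, ENNReal.ofReal (1 - x) ^ k = ENNReal.ofReal (2 * A / θ) := by
    rw [ENNReal.tsum_geometric, ← ENNReal.ofReal_one, ← ENNReal.ofReal_sub _ (by linarith),
      ← ENNReal.ofReal_inv_of_pos (by linarith)]
    congr 1
    rw [sub_sub_cancel, hx, inv_div]
  have hlδ : l ^ δ ≤ ENNReal.ofReal (3 ^ n) * maximal h z ^ δ := by
    rw [hl, ENNReal.mul_rpow_of_nonneg _ _ hδ.le]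
    gcongr
    have h1 : (1 : ℝ≥0∞) ≤ ENNReal.ofReal (3 ^ n) := by
      rw [← ENNReal.ofReal_one]
      exact ENNReal.ofReal_le_ofReal (one_le_pow₀ (by norm_num))
    simpa using ENNReal.rpow_le_rpow_of_exponent_le h1 hδ1
  have h1x : 0 ≤ 1 - x := by linarith
  have h2x : 0 ≤ 1 - 2 * x := by linarith
  calc ∫⁻ y in Q, maximal h y ^ δ ∂μ
      ≤ ∫⁻ y in Q, l ^ δ + ∑' k : ℕ, (E k).indicator (fun _ => (d ^ (k + 1) * l) ^ δ) y ∂μ :=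
        setLIntegral_mono' Metric.isClosed_closedBall.measurableSet hpoint
    _ = l ^ δ * μ Q +
        ∑' k : ℕ, ∫⁻ y in Q, (E k).indicator (fun _ => (d ^ (k + 1) * l) ^ δ) y ∂μ := by
        rw [lintegral_add_left measurable_const, setLIntegral_const, lintegral_tsum]
        exact fun k => (measurable_const.indicator (hEm k)).aemeasurable
    _ ≤ l ^ δ * μ Q + ∑' k : ℕ, (l ^ δ * ENNReal.ofReal (D ^ δ) ^ (k + 1)) *
          (ENNReal.ofReal (1 - 2 * x) ^ k * (ENNReal.ofReal (A * 5 ^ n) * μ Q)) := by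
        gcongr with k
        refine (setLIntegral_le_lintegral _ _).trans ?_
        rw [lintegral_indicator (hEm k), setLIntegral_const, hpow]
        gcongr
        exact hmass k
    _ ≤ l ^ δ * μ Q + ∑' k : ℕ, (l ^ δ * (ENNReal.ofReal 3 * ENNReal.ofReal (A * 5 ^ n)) * μ Q) *
          ENNReal.ofReal (1 - x) ^ k := by
        refine add_le_add le_rfl (ENNReal.tsum_le_tsum fun k => ?_)
        calc (l ^ δ * ENNReal.ofReal (D ^ δ) ^ (k + 1)) *
              (ENNReal.ofReal (1 - 2 * x) ^ k * (ENNReal.ofReal (A * 5 ^ n) * μ Q))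
            = l ^ δ * (ENNReal.ofReal (D ^ δ) * ENNReal.ofReal (A * 5 ^ n)) * μ Q *
              (ENNReal.ofReal (D ^ δ) * ENNReal.ofReal (1 - 2 * x)) ^ k := by ring
          _ ≤ _ := by
              rw [← ENNReal.ofReal_mul (p := D ^ δ) (q := 1 - 2 * x) (by positivity)]
              gcongr
    _ = l ^ δ * μ Q * ENNReal.ofReal (1 + 3 * 5 ^ n * (2 / θ) * A ^ 2) := by
        rw [ENNReal.tsum_mul_left, hgeom, ← ENNReal.ofReal_mul (by norm_num),
          ENNReal.ofReal_add (by norm_num) (by positivity), ENNReal.ofReal_one, mul_add, mul_one]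
        congr 1
        rw [show 3 * 5 ^ n * (2 / θ) * A ^ 2 = (3 * (A * 5 ^ n)) * (2 * A / θ) by ring,
          ENNReal.ofReal_mul (p := 3 * (A * 5 ^ n)) (by positivity)]
        ring
    _ ≤ (ENNReal.ofReal (3 ^ n) * maximal h z ^ δ) * μ Q *
        ENNReal.ofReal ((1 + 3 * 5 ^ n * (2 / θ)) * A ^ 2) := by
        gcongr
        nlinarith [show (0 : ℝ) ≤ 3 * 5 ^ n * (2 / θ) by positivity]
    _ = _ := by
        rw [mul_assoc (3 ^ n), ENNReal.ofReal_mul (p := 3 ^ n) (by positivity)]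
        ring

/-- Hölder with `N` equal exponents reduces to single factors raised to `N * γ j`, whence the
smallness condition. Each factor contributes the `N`-th root of the constant, so the constant does
not grow with `N`. -/
lemma exists_setLIntegral_prod_maximal_rpow_le (n : ℕ) : ∃ δ₀ C : ℝ, 0 < δ₀ ∧ 1 ≤ C ∧
    ∀ (u : (Fin n → ℝ) → ℝ≥0∞) (A : ℝ), IsWeight u → 1 ≤ A →
      (∀ᵐ x, maximal u x ≤ ENNReal.ofReal A * u x) →
      ∀ (N : ℕ) (h : Fin N → (Fin n → ℝ) → ℝ≥0∞) (γ : Fin N → ℝ), (∀ j, 0 < γ j) →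
      (∀ j, N * γ j ≤ δ₀ / A) → (∀ j x, 0 < maximal (h j) x) →
      ∀ (c z : Fin n → ℝ) (r : ℝ), 0 < r → z ∈ Metric.closedBall c r →
        ∫⁻ y in Metric.closedBall c r, ∏ j, maximal (h j) y ^ γ j ∂(volume.withDensity u) ≤
          ENNReal.ofReal (C * A ^ 2) * (∏ j, maximal (h j) z ^ γ j) *
            volume.withDensity u (Metric.closedBall c r) := by
  obtain ⟨δ₀, C, hδ₀, hC, H⟩ := exists_setLIntegral_maximal_rpow_le n
  refine ⟨δ₀, C, hδ₀, hC, ?_⟩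
  intro u A hu hA1 hA N h γ hγ hγA hpos c z r hr hz
  set μ := volume.withDensity u
  set Q := Metric.closedBall c r
  rcases Nat.eq_zero_or_pos N with rfl | hN
  · simp only [Finset.univ_eq_empty, Finset.prod_empty, setLIntegral_const, one_mul, mul_one]
    nth_rw 1 [← one_mul (μ Q)]
    gcongr
    rw [← ENNReal.ofReal_one]
    exact ENNReal.ofReal_le_ofReal (one_le_mul_of_one_le_of_one_le hC (one_le_pow₀ hA1))
  have hN' : (0 : ℝ) < N := by exact_mod_cast hN
  have hroot : ∀ (a : ℝ≥0∞) (j : Fin N), (a ^ (N * γ j)) ^ (1 / (N : ℝ)) = a ^ γ j := by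
    intro a j
    rw [← ENNReal.rpow_mul]
    congr 1
    field_simp
  calc ∫⁻ y in Q, ∏ j, maximal (h j) y ^ γ j ∂μ
      = ∫⁻ y in Q, ∏ j, (maximal (h j) y ^ (N * γ j)) ^ (1 / (N : ℝ)) ∂μ := by
        simp only [hroot]
    _ ≤ ∏ j, (∫⁻ y in Q, maximal (h j) y ^ (N * γ j) ∂μ) ^ (1 / (N : ℝ)) := by
        refine ENNReal.lintegral_prod_norm_pow_le _
          (fun j _ => ((measurable_maximal (h j)).pow_const _).aemeasurable) ?_
          fun _ _ => by positivity
        simp [hN'.ne']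
    _ ≤ ∏ j, (ENNReal.ofReal (C * A ^ 2) * maximal (h j) z ^ (N * γ j) * μ Q) ^
          (1 / (N : ℝ)) := by
        gcongr with j
        exact H u A hu hA1 hA (h j) (N * γ j) (mul_pos hN' (hγ j)) (hγA j) c z r hr hz (hpos j z)
    _ = ∏ j, ((ENNReal.ofReal (C * A ^ 2) * μ Q) ^ (1 / (N : ℝ)) * maximal (h j) z ^ γ j) := by
        refine Finset.prod_congr rfl fun j _ => ?_
        rw [mul_right_comm, ENNReal.mul_rpow_of_nonneg _ _ (by positivity), hroot]
    _ = _ := by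
        rw [Finset.prod_mul_distrib, Finset.prod_const, Finset.card_univ, Fintype.card_fin,
          ← ENNReal.rpow_natCast, ← ENNReal.rpow_mul, one_div, inv_mul_cancel₀ hN'.ne',
          ENNReal.rpow_one]
        ring

/-! ### The weak type inequality -/

lemma setLIntegral_withDensity_eq {u f : (Fin n → ℝ) → ℝ≥0∞} (hu : AEMeasurable u)
    (hf : AEMeasurable f) {s : Set (Fin n → ℝ)} (hs : MeasurableSet s) :
    ∫⁻ y in s, f y ∂(volume.withDensity u) = ∫⁻ y in s, u y * f y := by
  rw [restrict_withDensity hs, lintegral_withDensity_eq_lintegral_mul₀ hu.restrict hf.restrict]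
  rfl

lemma rpow_setLIntegral_le {μ : Measure (Fin n → ℝ)} {f ν : (Fin n → ℝ) → ℝ≥0∞} {q : ℝ}
    (hq : 1 < q) (hf : AEMeasurable f μ) (hν : Measurable ν) (hν0 : ∀ᵐ x ∂μ, ν x ≠ 0)
    (hνt : ∀ᵐ x ∂μ, ν x ≠ ∞) :
    (∫⁻ y, f y ∂μ) ^ q ≤
      (∫⁻ y, f y ^ q * ν y ∂μ) * (∫⁻ y, ν y ^ (-1 / (q - 1)) ∂μ) ^ (q - 1) := by
  have hq0 : 0 < q := by linarith
  have hq1 : 0 < q - 1 := by linarith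
  have hconj : q.HolderConjugate (q / (q - 1)) := Real.HolderConjugate.conjExponent hq
  have hold := ENNReal.lintegral_mul_le_Lp_mul_Lq μ hconj
    (f := fun y => f y * ν y ^ (1 / q)) (g := fun y => ν y ^ (-(1 / q)))
    (hf.mul (hν.pow_const _).aemeasurable) (hν.pow_const _).aemeasurable
  have h1 : ∫⁻ y, ((fun y => f y * ν y ^ (1 / q)) * fun y => ν y ^ (-(1 / q))) y ∂μ =
      ∫⁻ y, f y ∂μ := by
    refine lintegral_congr_ae ?_
    filter_upwards [hν0, hνt] with y hy0 hyt
    simp only [Pi.mul_apply]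
    rw [mul_assoc, ← ENNReal.rpow_add _ _ hy0 hyt, add_neg_cancel, ENNReal.rpow_zero, mul_one]
  have h2 : ∀ y, (f y * ν y ^ (1 / q)) ^ q = f y ^ q * ν y := by
    intro y
    rw [ENNReal.mul_rpow_of_nonneg _ _ hq0.le, ← ENNReal.rpow_mul, one_div,
      inv_mul_cancel₀ hq0.ne', ENNReal.rpow_one]
  have h3 : ∀ y, (ν y ^ (-(1 / q))) ^ (q / (q - 1)) = ν y ^ (-1 / (q - 1)) := by
    intro y
    rw [← ENNReal.rpow_mul]
    congr 1
    field_simp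
  rw [h1] at hold
  simp only [h2, h3] at hold
  calc (∫⁻ y, f y ∂μ) ^ q ≤ _ := ENNReal.rpow_le_rpow hold hq0.le
    _ = _ := by
      rw [ENNReal.mul_rpow_of_nonneg _ _ hq0.le, ← ENNReal.rpow_mul, ← ENNReal.rpow_mul, one_div,
        inv_mul_cancel₀ hq0.ne', ENNReal.rpow_one]
      congr 2
      field_simp

/-- If the average of `u f` over a cube `Q ∋ x` exceeds `t u(x)`, the `A₁` condition turns this into
`t μ(Q) ≤ A ∫_Q f dμ`. Hölder against `ν` and the `A_q` condition on the dilated cube then give the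
estimate needed for Vitali. One factor `A` comes from this comparison, the other from doubling. -/
lemma weak_type_opL {u ν f : (Fin n → ℝ) → ℝ≥0∞} {A K q : ℝ} (hu : IsWeight u) (hA1 : 1 ≤ A)
    (hA : ∀ᵐ x, maximal u x ≤ ENNReal.ofReal A * u x) (hK : 1 ≤ K) (hq : 1 < q)
    (hν : Measurable ν) (hν0 : ∀ᵐ x, ν x ≠ 0) (hνt : ∀ᵐ x, ν x ≠ ∞)
    (hνK : ∀ (c z : Fin n → ℝ) (r : ℝ), 0 < r → z ∈ Metric.closedBall c r →
      ∫⁻ y in Metric.closedBall c r, ν y ^ (-1 / (q - 1)) ∂(volume.withDensity u) ≤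
        ENNReal.ofReal K * ν z ^ (-1 / (q - 1)) * volume.withDensity u (Metric.closedBall c r))
    (hf : AEMeasurable f) {t : ℝ≥0∞} (ht : t ≠ 0) (ht' : t ≠ ∞) :
    volume.withDensity (fun x => u x * ν x) {x | t < opL u f x} ≤
      (ENNReal.ofReal (K * A ^ 2 * 5 ^ n) / t) ^ q *
        ∫⁻ y, f y ^ q ∂(volume.withDensity fun x => u x * ν x) := by
  set μ := volume.withDensity u with hμ
  set w := volume.withDensity (fun x => u x * ν x) with hw
  have hwμ : w = μ.withDensity ν := withDensity_mul₀ hu.aemeasurable hν.aemeasurable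
  set G := ENNReal.ofReal (K * A ^ 2 * 5 ^ n) with hG
  have hq0 : 0 < q := by linarith
  have hq1 : 0 < q - 1 := by linarith
  have hfμ : AEMeasurable f μ := hf.mono' (withDensity_absolutelyContinuous _ _)
  have hac : μ ≪ volume := withDensity_absolutelyContinuous _ _
  have hGt : (G / t) ^ q ≠ ∞ :=
    ENNReal.rpow_ne_top_of_nonneg hq0.le (ENNReal.div_ne_top ENNReal.ofReal_ne_top ht)
  have hfw : ∫⁻ y, f y ^ q ∂w = ∫⁻ y, f y ^ q * ν y ∂μ := by
    rw [hwμ, lintegral_withDensity_eq_lintegral_mul₀ hν.aemeasurable (hfμ.pow_const q)]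
    simp only [Pi.mul_apply, mul_comm]
  rw [hfw, ← lintegral_const_mul' _ _ hGt]
  have hgood : ∀ᵐ x ∂w, maximal u x ≤ ENNReal.ofReal A * u x ∧ 0 < u x ∧ u x < ∞ := by
    refine (withDensity_absolutelyContinuous _ _ : w ≪ volume).ae_le ?_
    filter_upwards [hA, hu.pos, hu.ae_lt_top] with x h1 h2 h3
    exact ⟨h1, h2, h3⟩
  have hle : w {x | t < opL u f x} ≤ w {x | t < opL u f x ∧
      maximal u x ≤ ENNReal.ofReal A * u x ∧ 0 < u x ∧ u x < ∞} := by
    refine measure_mono_ae ?_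
    filter_upwards [hgood] with x hx hxt
    exact ⟨hxt, hx⟩
  refine hle.trans (measure_le_lintegral_of_forall_cube ?_)
  rintro x ⟨hxt, hxA, hx0, hxtop⟩
  rw [opL, ENNReal.lt_div_iff_mul_lt (Or.inl hx0.ne') (Or.inl hxtop.ne)] at hxt
  obtain ⟨c, r, hr, hxc, hav⟩ := lt_maximal_iff.1 hxt
  refine ⟨c, r, hr, hxc, ?_⟩
  rw [lintegral_const_mul' _ _ hGt]
  set Q := Metric.closedBall c r with hQ
  set Q5 := Metric.closedBall c (5 * r) with hQ5
  have hQm : MeasurableSet Q := Metric.isClosed_closedBall.measurableSet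
  have hQ5m : MeasurableSet Q5 := Metric.isClosed_closedBall.measurableSet
  have hv0 : volume Q ≠ 0 := volume_cube_pos c hr
  have hvt : volume Q ≠ ∞ := volume_cube_ne_top c r
  have ha0 : μ Q ≠ 0 := hu.measure_cube_ne_zero c hr
  have hat : μ Q ≠ ∞ := hu.measure_cube_ne_top c r
  have htQ : t * μ Q ≤ ENNReal.ofReal A * ∫⁻ y in Q, f y ∂μ := by
    rw [setLIntegral_withDensity_eq hu.aemeasurable hf hQm]
    have h1 : μ Q ≤ ENNReal.ofReal A * u x * volume Q := by
      rw [hμ, withDensity_apply' u]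
      exact (setLIntegral_cube_le u hr hxc).trans (by gcongr)
    have h2 : t * u x * volume Q ≤ ∫⁻ y in Q, u y * f y :=
      ((ENNReal.lt_div_iff_mul_lt (Or.inl hv0) (Or.inl hvt)).1 hav).le
    calc t * μ Q ≤ t * (ENNReal.ofReal A * u x * volume Q) := by gcongr
      _ = ENNReal.ofReal A * (t * u x * volume Q) := by ring
      _ ≤ _ := by gcongr
  set S := ∫⁻ y in Q5, ν y ^ (-1 / (q - 1)) ∂μ with hS
  set F := ∫⁻ y in Q, f y ^ q * ν y ∂μ with hF
  have hHolder : (∫⁻ y in Q, f y ∂μ) ^ q ≤ F * S ^ (q - 1) := by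
    refine (rpow_setLIntegral_le hq hfμ.restrict hν (ae_restrict_of_ae (hac.ae_le hν0))
      (ae_restrict_of_ae (hac.ae_le hνt))).trans ?_
    refine mul_le_mul' le_rfl (ENNReal.rpow_le_rpow (lintegral_mono_set ?_) hq1.le)
    exact Metric.closedBall_subset_closedBall (by linarith)
  -- The dual weight being `A₁` relative to `μ` implies `A_q` for `ν`: the bound on `S` holds at
  -- every `z`, so its power `q - 1` times `ν z` is bounded by a constant, which is integrated in
  -- `z`.
  have hwS : w Q5 * S ^ (q - 1) ≤ (ENNReal.ofReal K * μ Q5) ^ (q - 1) * μ Q5 := by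
    have h1 : w Q5 = ∫⁻ z in Q5, ν z ∂μ := by rw [hwμ, withDensity_apply _ hQ5m]
    rw [h1, ← lintegral_mul_const _ hν, ← setLIntegral_const]
    refine setLIntegral_mono' hQ5m fun z hz => ?_
    calc ν z * S ^ (q - 1)
        ≤ ν z * (ENNReal.ofReal K * ν z ^ (-1 / (q - 1)) * μ Q5) ^ (q - 1) := by
          gcongr
          exact hνK c z (5 * r) (by positivity) hz
      _ = ν z * (ν z)⁻¹ * (ENNReal.ofReal K * μ Q5) ^ (q - 1) := by
          rw [mul_right_comm, ENNReal.mul_rpow_of_nonneg _ _ hq1.le, ← ENNReal.rpow_mul,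
            div_mul_cancel₀ _ hq1.ne', ENNReal.rpow_neg_one]
          ring
      _ ≤ 1 * (ENNReal.ofReal K * μ Q5) ^ (q - 1) := by
          gcongr
          exact ENNReal.mul_inv_le_one _
      _ = _ := one_mul _
  have hK1 : 1 ≤ ENNReal.ofReal K := by
    rw [← ENNReal.ofReal_one]
    exact ENNReal.ofReal_le_ofReal hK
  have hwS' : w Q5 * S ^ (q - 1) ≤ (ENNReal.ofReal K * μ Q5) ^ q := by
    refine hwS.trans ?_
    calc (ENNReal.ofReal K * μ Q5) ^ (q - 1) * μ Q5
        ≤ (ENNReal.ofReal K * μ Q5) ^ (q - 1) * (ENNReal.ofReal K * μ Q5) ^ (1 : ℝ) := by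
          gcongr
          rw [ENNReal.rpow_one]
          exact le_mul_of_one_le_left zero_le hK1
      _ = _ := by
          rw [← ENNReal.rpow_add_of_nonneg _ _ hq1.le zero_le_one]
          congr 1
          ring
  have hfinal : w Q5 * t ^ q * μ Q ^ q ≤ G ^ q * F * μ Q ^ q := by
    calc w Q5 * t ^ q * μ Q ^ q = w Q5 * (t * μ Q) ^ q := by
          rw [ENNReal.mul_rpow_of_nonneg _ _ hq0.le]
          ring
      _ ≤ w Q5 * (ENNReal.ofReal A * ∫⁻ y in Q, f y ∂μ) ^ q := by gcongr
      _ = ENNReal.ofReal A ^ q * w Q5 * (∫⁻ y in Q, f y ∂μ) ^ q := by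
          rw [ENNReal.mul_rpow_of_nonneg _ _ hq0.le]
          ring
      _ ≤ ENNReal.ofReal A ^ q * w Q5 * (F * S ^ (q - 1)) := by gcongr
      _ = ENNReal.ofReal A ^ q * (w Q5 * S ^ (q - 1)) * F := by ring
      _ ≤ ENNReal.ofReal A ^ q * (ENNReal.ofReal K * (ENNReal.ofReal (A * 5 ^ n) * μ Q)) ^ q *
            F := by
          gcongr
          refine hwS'.trans ?_
          gcongr
          exact measure_cube_five_mul_le (by linarith) hA c hr
      _ = G ^ q * F * μ Q ^ q := by
          rw [← ENNReal.mul_rpow_of_nonneg _ _ hq0.le, ← mul_assoc, ← mul_assoc,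
            ENNReal.mul_rpow_of_nonneg _ (μ Q) hq0.le, hG, ← ENNReal.ofReal_mul (by linarith),
            ← ENNReal.ofReal_mul (by nlinarith),
            show A * K * (A * 5 ^ n) = K * A ^ 2 * 5 ^ n by ring]
          ring
  have haq0 : μ Q ^ q ≠ 0 := by simp [ENNReal.rpow_eq_zero_iff, ha0, hat]
  have haqt : μ Q ^ q ≠ ∞ := ENNReal.rpow_ne_top_of_nonneg hq0.le hat
  rw [ENNReal.mul_le_mul_iff_left haq0 haqt] at hfinal
  have htq0 : t ^ q ≠ 0 := by simp [ENNReal.rpow_eq_zero_iff, ht, ht']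
  have htqt : t ^ q ≠ ∞ := ENNReal.rpow_ne_top_of_nonneg hq0.le ht'
  rw [ENNReal.div_rpow_of_nonneg _ _ hq0.le, ← ENNReal.mul_div_right_comm]
  exact (ENNReal.le_div_iff_mul_le (Or.inl htq0) (Or.inl htqt)).2 hfinal

/-! ### Lorentz norms -/

lemma tsum_rpow_le (a : ℕ → ℝ≥0∞) {s : ℝ} (hs : 0 < s) (hs1 : s ≤ 1) :
    (∑' k, a k) ^ s ≤ ∑' k, a k ^ s := by
  have hfin : ∀ m : ℕ, (∑ k ∈ Finset.range m, a k) ^ s ≤ ∑ k ∈ Finset.range m, a k ^ s := by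
    intro m
    induction m with
    | zero => simp [hs]
    | succ m ih =>
      rw [Finset.sum_range_succ, Finset.sum_range_succ]
      exact (ENNReal.rpow_add_le_add_rpow _ _ hs.le hs1).trans (add_le_add ih le_rfl)
  refine le_of_tendsto' (((ENNReal.continuous_rpow_const (y := s)).tendsto _).comp
    (ENNReal.tendsto_nat_tsum a)) fun m => ?_
  exact (hfin m).trans (ENNReal.sum_le_tsum _)

lemma setLIntegral_Ioi_comp_mul (F : ℝ → ℝ≥0∞) {a : ℝ} (ha : 0 < a) :
    ∫⁻ t in Set.Ioi (0 : ℝ), F (a * t) = ENNReal.ofReal a⁻¹ * ∫⁻ t in Set.Ioi (0 : ℝ), F t := by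
  have hind : ∀ t : ℝ, (Set.Ioi (0 : ℝ)).indicator (fun t => F (a * t)) t =
      (Set.Ioi (0 : ℝ)).indicator F (a * t) := by
    intro t
    by_cases ht : 0 < t
    · rw [Set.indicator_of_mem (by exact ht), Set.indicator_of_mem (by exact mul_pos ha ht)]
    · rw [Set.indicator_of_notMem (by exact ht),
        Set.indicator_of_notMem (by simpa [ha] using ht)]
  rw [← lintegral_indicator measurableSet_Ioi, ← lintegral_indicator measurableSet_Ioi]
  simp only [hind]
  have h := lintegral_map_equiv (μ := volume) ((Set.Ioi (0 : ℝ)).indicator F)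
    (Homeomorph.mulLeft₀ a ha.ne').toMeasurableEquiv
  have hmap : Measure.map (Homeomorph.mulLeft₀ a ha.ne').toMeasurableEquiv volume =
      ENNReal.ofReal |a⁻¹| • volume := Real.map_volume_mul_left ha.ne'
  rw [hmap, lintegral_smul_measure, abs_of_pos (inv_pos.2 ha)] at h
  exact h.symm

lemma antitone_measure_lt_rpow (μ : Measure (Fin n → ℝ)) (f : (Fin n → ℝ) → ℝ≥0∞) {p : ℝ}
    (hp : 0 < p) : Antitone fun t : ℝ => μ {x | ENNReal.ofReal t < f x} ^ (1 / p) := by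
  intro t t' htt'
  refine ENNReal.rpow_le_rpow (measure_mono fun x hx => ?_) (by positivity)
  exact (ENNReal.ofReal_le_ofReal htt').trans_lt hx

lemma lorentzNorm_comp_mul (w f : (Fin n → ℝ) → ℝ≥0∞) (p : ℝ) {a : ℝ} (ha : 0 < a) :
    ENNReal.ofReal p * ∫⁻ t in Set.Ioi (0 : ℝ),
      (volume.withDensity w {x | ENNReal.ofReal (a * t) < f x}) ^ (1 / p) =
      ENNReal.ofReal a⁻¹ * lorentzNorm p w f := by
  rw [setLIntegral_Ioi_comp_mul
    (fun t => (volume.withDensity w {x | ENNReal.ofReal t < f x}) ^ (1 / p)) ha, lorentzNorm]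
  ring

/-- A substitute for the triangle inequality: if the sum exceeds `t = ∑ a k * t`, some `g k` exceeds
`a k * t`, and the power `1 / p ≤ 1` is subadditive. The loss `(a k)⁻¹` is harmless for
geometrically decaying terms. -/
lemma lorentzNorm_tsum_le (w : (Fin n → ℝ) → ℝ≥0∞) (g : ℕ → (Fin n → ℝ) → ℝ≥0∞) {p : ℝ}
    (hp : 1 ≤ p) {a : ℕ → ℝ} (ha : ∀ k, 0 < a k) (hsum : HasSum a 1) :
    lorentzNorm p w (fun x => ∑' k, g k x) ≤
      ∑' k, ENNReal.ofReal (a k)⁻¹ * lorentzNorm p w (g k) := by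
  have hp0 : 0 < p := by linarith
  have hmeas : ∀ k, Measurable fun t : ℝ =>
      (volume.withDensity w {x | ENNReal.ofReal (a k * t) < g k x}) ^ (1 / p) := fun k =>
    (antitone_measure_lt_rpow _ (g k) hp0).measurable.comp (measurable_const_mul (a k))
  simp only [← lorentzNorm_comp_mul w _ p (ha _)]
  rw [ENNReal.tsum_mul_left, ← lintegral_tsum fun k => (hmeas k).aemeasurable, lorentzNorm]
  gcongr ENNReal.ofReal p * ?_
  refine setLIntegral_mono' measurableSet_Ioi fun t ht => ?_
  refine le_trans ?_ (tsum_rpow_le _ (by positivity) (by rw [div_le_one hp0]; exact hp))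
  refine ENNReal.rpow_le_rpow ?_ (by positivity)
  refine (measure_mono ?_).trans (measure_iUnion_le _)
  intro x (hx : ENNReal.ofReal t < ∑' k, g k x)
  by_contra hcon
  simp only [Set.mem_iUnion, not_exists] at hcon
  refine absurd hx (not_lt.2 ?_)
  have hle : ∀ k, g k x ≤ ENNReal.ofReal (a k * t) := fun k => not_lt.1 (hcon k)
  have hs : HasSum (fun k => a k * t) t := by simpa using hsum.mul_right t
  calc ∑' k, g k x ≤ ∑' k, ENNReal.ofReal (a k * t) := ENNReal.tsum_le_tsum hle
    _ = ENNReal.ofReal t := by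
      rw [← ENNReal.ofReal_tsum_of_nonneg (fun k => (mul_pos (ha k) ht).le) hs.summable,
        hs.tsum_eq]

lemma lorentzNorm_div_ofReal (w f : (Fin n → ℝ) → ℝ≥0∞) (p : ℝ) {a : ℝ} (ha : 0 < a) :
    lorentzNorm p w (fun x => f x / ENNReal.ofReal a) = ENNReal.ofReal a⁻¹ * lorentzNorm p w f := by
  rw [← lorentzNorm_comp_mul w f p ha, lorentzNorm]
  congr 1
  refine setLIntegral_congr_fun measurableSet_Ioi fun t ht => ?_
  congr 2
  ext x
  rw [Set.mem_ofPred, Set.mem_ofPred,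
    ENNReal.lt_div_iff_mul_lt (Or.inl (by simpa using ha)) (Or.inl ENNReal.ofReal_ne_top),
    mul_comm a, ENNReal.ofReal_mul (le_of_lt ht)]

/-- Truncation at height `l`: the part of `f` below `l` is controlled by `L_u 1 = M u / u ≤ A`. -/
lemma opL_le_add {u f : (Fin n → ℝ) → ℝ≥0∞} {A : ℝ} (hu : IsWeight u)
    (hA : ∀ᵐ x, maximal u x ≤ ENNReal.ofReal A * u x) {l : ℝ≥0∞}
    (hl : l ≠ ∞) :
    ∀ᵐ x, opL u f x ≤ ENNReal.ofReal A * l + opL u ({x | l < f x}.indicator f) x := by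
  filter_upwards [hA, hu.pos, hu.ae_lt_top] with x hx h0 ht
  unfold opL
  refine ENNReal.div_le_of_le_mul ?_
  rw [add_mul, ENNReal.div_mul_cancel h0.ne' ht.ne]
  calc maximal (fun y => u y * f y) x
      ≤ maximal (fun y => l * u y + u y * {x | l < f x}.indicator f y) x := by
        refine maximal_mono_ae (Eventually.of_forall fun y => ?_) x
        by_cases hy : l < f y
        · rw [Set.indicator_of_mem (by exact hy)]
          exact le_add_self
        · rw [mul_comm]
          refine le_trans ?_ le_self_add
          gcongr
          exact not_lt.1 hy
    _ ≤ maximal (fun y => l * u y) x + maximal (fun y => u y * {x | l < f x}.indicator f y) x :=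
        maximal_add_le (hu.aemeasurable.const_mul l) x
    _ ≤ _ := by
        gcongr
        calc maximal (fun y => l * u y) x ≤ l * maximal u x := maximal_const_mul_le hl u x
          _ ≤ l * (ENNReal.ofReal A * u x) := by gcongr
          _ = _ := by ring

lemma lintegral_indicator_rpow_le {μ : Measure (Fin n → ℝ)} {f : (Fin n → ℝ) → ℝ≥0∞}
    (hf : AEMeasurable f μ) {D l : ℝ≥0∞} (hD : 1 < D) (hl : l ≠ 0) {q : ℝ} (hq : 0 < q) :
    ∫⁻ x, ({x | l < f x}.indicator f x) ^ q ∂μ ≤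
      ∑' k : ℕ, (D ^ (k + 1) * l) ^ q * μ {x | D ^ k * l < f x} := by
  have hm : ∀ k : ℕ, NullMeasurableSet {x | D ^ k * l < f x} μ := fun k =>
    nullMeasurableSet_lt aemeasurable_const hf
  calc ∫⁻ x, ({x | l < f x}.indicator f x) ^ q ∂μ
      ≤ ∫⁻ x, ∑' k : ℕ, {x | D ^ k * l < f x}.indicator (fun _ => (D ^ (k + 1) * l) ^ q) x ∂μ := by
        refine lintegral_mono fun x => ?_
        by_cases hx : l < f x
        · rw [Set.indicator_of_mem (by exact hx)]
          exact rpow_le_tsum_indicator hD hl hx hq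
        · rw [Set.indicator_of_notMem (by exact hx), ENNReal.zero_rpow_of_pos hq]
          exact zero_le
    _ = ∑' k : ℕ, (D ^ (k + 1) * l) ^ q * μ {x | D ^ k * l < f x} := by
        rw [lintegral_tsum fun k => aemeasurable_const.indicator₀ (hm k)]
        refine tsum_congr fun k => ?_
        rw [lintegral_indicator₀ (hm k), setLIntegral_const]

/-- A weak type `(q, q)` inequality together with the trivial bound on `L^∞` gives a bound on
`L^{p,1}` for `4 q ≤ p`. -/
lemma lorentzNorm_opL_le {u w f : (Fin n → ℝ) → ℝ≥0∞} {A Y p q : ℝ} (hu : IsWeight u)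
    (hA1 : 1 ≤ A) (hA : ∀ᵐ x, maximal u x ≤ ENNReal.ofReal A * u x) (hY : 1 ≤ Y) (hq : 1 ≤ q)
    (hpq : 4 * q ≤ p)
    (hweak : ∀ (g : (Fin n → ℝ) → ℝ≥0∞) (t : ℝ≥0∞), AEMeasurable g → t ≠ 0 → t ≠ ∞ →
      volume.withDensity w {x | t < opL u g x} ≤
        (ENNReal.ofReal (A * Y ^ 4) / t) ^ q * ∫⁻ y, g y ^ q ∂(volume.withDensity w))
    (hf : AEMeasurable f) :
    lorentzNorm p w (opL u f) ≤ ENNReal.ofReal (8 * A * Y) * lorentzNorm p w f := by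
  set μ := volume.withDensity w
  have hA0 : 0 < A := by linarith
  have hY0 : 0 < Y := by linarith
  have hq0 : 0 < q := by linarith
  have hp0 : 0 < p := by linarith
  have hp1 : 1 / p ≤ 1 := by rw [div_le_one hp0]; linarith
  have hac : μ ≪ volume := withDensity_absolutelyContinuous _ _
  have hfμ : AEMeasurable f μ := hf.mono' hac
  have hlevel : ∀ t ∈ Set.Ioi (0 : ℝ),
      μ {x | ENNReal.ofReal (2 * A * t) < opL u f x} ^ (1 / p) ≤
        ∑' k : ℕ, ENNReal.ofReal (Y * 2 ^ (k + 1)) *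
          μ {x | ENNReal.ofReal (16 ^ k * t) < f x} ^ (1 / p) := by
    intro t (ht : 0 < t)
    set l := ENNReal.ofReal t with hl
    have hl0 : l ≠ 0 := by simpa [hl] using ht
    have hlt : l ≠ ∞ := ENNReal.ofReal_ne_top
    have hAl : ENNReal.ofReal (A * t) = ENNReal.ofReal A * l := ENNReal.ofReal_mul hA0.le
    have hsub : μ {x | ENNReal.ofReal (2 * A * t) < opL u f x} ≤
        μ {x | ENNReal.ofReal (A * t) < opL u ({x | l < f x}.indicator f) x} := by
      refine measure_mono_ae ?_
      filter_upwards [hac.ae_le (opL_le_add hu hA hlt)] with x hx hxt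
      have hxt' : ENNReal.ofReal (2 * A * t) < opL u f x := hxt
      change ENNReal.ofReal (A * t) < opL u ({x | l < f x}.indicator f) x
      have h2 : ENNReal.ofReal (2 * A * t) = ENNReal.ofReal (A * t) + ENNReal.ofReal (A * t) := by
        rw [← ENNReal.ofReal_add (by positivity) (by positivity)]
        congr 1
        ring
      rw [h2] at hxt'
      rw [← hAl] at hx
      exact (ENNReal.add_lt_add_iff_left ENNReal.ofReal_ne_top).1 (hxt'.trans_le hx)
    have hw := hweak ({x | l < f x}.indicator f) (ENNReal.ofReal (A * t))
      (hf.indicator₀ (nullMeasurableSet_lt aemeasurable_const hf))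
      (by simpa using mul_pos hA0 ht) ENNReal.ofReal_ne_top
    have hint := lintegral_indicator_rpow_le hfμ (D := 16) (by norm_num) hl0 hq0
    have hratio : ENNReal.ofReal (A * Y ^ 4) / ENNReal.ofReal (A * t) =
        ENNReal.ofReal (Y ^ 4 / t) := by
      rw [← ENNReal.ofReal_div_of_pos (by positivity)]
      congr 1
      field_simp
    have h16 : ∀ k : ℕ, (16 : ℝ≥0∞) ^ k * l = ENNReal.ofReal (16 ^ k * t) := by
      intro k
      rw [ENNReal.ofReal_mul (by positivity), ENNReal.ofReal_pow (by norm_num),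
        ENNReal.ofReal_ofNat]
    calc μ {x | ENNReal.ofReal (2 * A * t) < opL u f x} ^ (1 / p)
        ≤ (∑' k : ℕ, ENNReal.ofReal ((Y * 2 ^ (k + 1)) ^ 4) ^ q *
            μ {x | ENNReal.ofReal (16 ^ k * t) < f x}) ^ (1 / p) := by
          refine ENNReal.rpow_le_rpow ((hsub.trans hw).trans ?_) (by positivity)
          rw [hratio]
          refine (mul_le_mul' le_rfl hint).trans (le_of_eq ?_)
          rw [← ENNReal.tsum_mul_left]
          refine tsum_congr fun k => ?_
          rw [h16, h16, ← mul_assoc, ← ENNReal.mul_rpow_of_nonneg _ _ hq0.le,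
            ← ENNReal.ofReal_mul (by positivity)]
          congr 3
          rw [mul_pow, ← pow_mul, mul_comm (k + 1), pow_mul, show (2 : ℝ) ^ 4 = 16 by norm_num]
          field_simp
      _ ≤ ∑' k : ℕ, (ENNReal.ofReal ((Y * 2 ^ (k + 1)) ^ 4) ^ q *
            μ {x | ENNReal.ofReal (16 ^ k * t) < f x}) ^ (1 / p) :=
          tsum_rpow_le _ (by positivity) hp1
      _ ≤ _ := by
          refine ENNReal.tsum_le_tsum fun k => ?_
          rw [ENNReal.mul_rpow_of_nonneg _ _ (by positivity), ← ENNReal.rpow_mul]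
          gcongr
          -- Since the base is at least `1` and `q / p ≤ 1 / 4`, the fourth power is undone. The
          -- remaining growth `2 ^ k` is beaten by the factor `16 ^ (-k)` that rescaling the level
          -- `16 ^ k * t` yields.
          have hbase : 1 ≤ Y * 2 ^ (k + 1) :=
            one_le_mul_of_one_le_of_one_le hY (one_le_pow₀ (by norm_num))
          calc ENNReal.ofReal ((Y * 2 ^ (k + 1)) ^ 4) ^ (q * (1 / p))
              ≤ ENNReal.ofReal ((Y * 2 ^ (k + 1)) ^ 4) ^ ((1 : ℝ) / 4) := by
                refine ENNReal.rpow_le_rpow_of_exponent_le ?_ ?_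
                · rw [← ENNReal.ofReal_one]
                  exact ENNReal.ofReal_le_ofReal (one_le_pow₀ hbase)
                · rw [mul_one_div, div_le_div_iff₀ hp0 (by norm_num)]
                  linarith
            _ = ENNReal.ofReal (Y * 2 ^ (k + 1)) := by
                rw [ENNReal.ofReal_pow (by positivity), ← ENNReal.rpow_natCast, ← ENNReal.rpow_mul]
                norm_num
  have hmeas : ∀ k : ℕ, Measurable fun t : ℝ =>
      ENNReal.ofReal (Y * 2 ^ (k + 1)) * μ {x | ENNReal.ofReal (16 ^ k * t) < f x} ^ (1 / p) :=
    fun k => ((antitone_measure_lt_rpow μ f hp0).measurable.comp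
      (measurable_const_mul ((16 : ℝ) ^ k))).const_mul _
  have hgeom : HasSum (fun k : ℕ => Y * 2 * (1 / 8 : ℝ) ^ k) (Y * 2 * (8 / 7)) := by
    have := (hasSum_geometric_of_lt_one (r := (1 / 8 : ℝ)) (by norm_num) (by norm_num)).mul_left
      (Y * 2)
    norm_num at this ⊢
    exact this
  have hscale : ENNReal.ofReal (2 * A)⁻¹ * lorentzNorm p w (opL u f) ≤
      ENNReal.ofReal (4 * Y) * lorentzNorm p w f := by
    rw [← lorentzNorm_comp_mul w _ p (by positivity : 0 < 2 * A)]
    calc ENNReal.ofReal p * ∫⁻ t in Set.Ioi (0 : ℝ),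
          μ {x | ENNReal.ofReal (2 * A * t) < opL u f x} ^ (1 / p)
        ≤ ENNReal.ofReal p * ∫⁻ t in Set.Ioi (0 : ℝ), ∑' k : ℕ, ENNReal.ofReal (Y * 2 ^ (k + 1)) *
          μ {x | ENNReal.ofReal (16 ^ k * t) < f x} ^ (1 / p) := by
          gcongr ENNReal.ofReal p * ?_
          exact setLIntegral_mono' measurableSet_Ioi hlevel
      _ = ∑' k : ℕ, ENNReal.ofReal (Y * 2 ^ (k + 1)) * (ENNReal.ofReal p *
          ∫⁻ t in Set.Ioi (0 : ℝ), μ {x | ENNReal.ofReal (16 ^ k * t) < f x} ^ (1 / p)) := by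
          rw [lintegral_tsum fun k => (hmeas k).aemeasurable, ← ENNReal.tsum_mul_left]
          refine tsum_congr fun k => ?_
          rw [lintegral_const_mul' _ _ ENNReal.ofReal_ne_top]
          ring
      _ = ∑' k : ℕ, ENNReal.ofReal (Y * 2 * (1 / 8 : ℝ) ^ k) * lorentzNorm p w f := by
          refine tsum_congr fun k => ?_
          rw [lorentzNorm_comp_mul w f p (by positivity : (0 : ℝ) < 16 ^ k), ← mul_assoc,
            ← ENNReal.ofReal_mul (by positivity)]
          congr 2
          rw [show (16 : ℝ) = 2 * 8 by norm_num, mul_pow, one_div, inv_pow]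
          field_simp
          ring
      _ = ENNReal.ofReal (Y * 2 * (8 / 7)) * lorentzNorm p w f := by
          rw [ENNReal.tsum_mul_right, ← ENNReal.ofReal_tsum_of_nonneg (fun k => by positivity)
            hgeom.summable, hgeom.tsum_eq]
      _ ≤ _ := by
          gcongr ?_ * _
          exact ENNReal.ofReal_le_ofReal (by linarith)
  calc lorentzNorm p w (opL u f)
      = ENNReal.ofReal (2 * A) * (ENNReal.ofReal (2 * A)⁻¹ * lorentzNorm p w (opL u f)) := by
        rw [← mul_assoc, ← ENNReal.ofReal_mul (by positivity), mul_inv_cancel₀ (by positivity),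
          ENNReal.ofReal_one, one_mul]
    _ ≤ ENNReal.ofReal (2 * A) * (ENNReal.ofReal (4 * Y) * lorentzNorm p w f) := by gcongr
    _ = _ := by
        rw [← mul_assoc, ← ENNReal.ofReal_mul (by positivity)]
        congr 2
        ring

/-- If `f` were infinite on a set of positive mass, the distribution function would be bounded below
by a positive constant on all of `(0, ∞)`. -/
lemma ae_lt_top_of_lorentzNorm_lt_top {w f : (Fin n → ℝ) → ℝ≥0∞} {p : ℝ} (hp : 0 < p)
    (hw : AEMeasurable w) (hw0 : ∀ᵐ x, w x ≠ 0) (hf : lorentzNorm p w f < ∞) :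
    ∀ᵐ x, f x < ∞ := by
  have hzero : volume.withDensity w {x | f x = ∞} = 0 := by
    by_contra hne
    refine hf.ne ?_
    have hconst : ∫⁻ _ in Set.Ioi (0 : ℝ), volume.withDensity w {x | f x = ∞} ^ (1 / p) = ∞ := by
      rw [setLIntegral_const, Real.volume_Ioi]
      refine ENNReal.mul_top ?_
      rw [Ne, ENNReal.rpow_eq_zero_iff_of_pos (by positivity)]
      exact hne
    have hle : ∞ ≤ ∫⁻ t in Set.Ioi (0 : ℝ),
        (volume.withDensity w {x | ENNReal.ofReal t < f x}) ^ (1 / p) := by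
      rw [← hconst]
      refine lintegral_mono fun t => ?_
      refine ENNReal.rpow_le_rpow (measure_mono fun x (hx : f x = ∞) => ?_) (by positivity)
      rw [Set.mem_ofPred, hx]
      exact ENNReal.ofReal_lt_top
    rw [lorentzNorm, top_le_iff.1 hle]
    exact ENNReal.mul_top (by simpa using hp)
  have hae : ∀ᵐ x ∂(volume.withDensity w), f x < ∞ := by
    rw [ae_iff]
    simpa using hzero
  rw [ae_withDensity_iff' hw] at hae
  filter_upwards [hae, hw0] with x h1 h2 using h1 h2

/-! ### The Rubio de Francia iteration -/

lemma aemeasurable_opL {u : (Fin n → ℝ) → ℝ≥0∞} (hu : AEMeasurable u)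
    (f : (Fin n → ℝ) → ℝ≥0∞) : AEMeasurable (opL u f) :=
  (measurable_maximal _).aemeasurable.div hu

lemma aemeasurable_iterate_opL {u g : (Fin n → ℝ) → ℝ≥0∞} (hu : AEMeasurable u)
    (hg : AEMeasurable g) (k : ℕ) : AEMeasurable ((opL u)^[k] g) := by
  cases k with
  | zero => exact hg
  | succ k =>
    rw [Function.iterate_succ_apply']
    exact aemeasurable_opL hu _

lemma le_opR (u : (Fin n → ℝ) → ℝ≥0∞) (K : ℝ) (g : (Fin n → ℝ) → ℝ≥0∞) (x : Fin n → ℝ) :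
    g x ≤ opR u K g x := by
  unfold opR
  refine le_trans (le_of_eq ?_) (ENNReal.le_tsum 0)
  simp

lemma lorentzNorm_opR_le {u w g : (Fin n → ℝ) → ℝ≥0∞} {p K : ℝ} (hu : AEMeasurable u)
    (hp : 1 ≤ p) (hK : 0 < K)
    (hL : ∀ f : (Fin n → ℝ) → ℝ≥0∞, AEMeasurable f →
      lorentzNorm p w (opL u f) ≤ ENNReal.ofReal K * lorentzNorm p w f)
    (hg : AEMeasurable g) :
    lorentzNorm p w (opR u (6 * K) g) ≤ 2 * lorentzNorm p w g := by
  have hiter : ∀ k : ℕ, lorentzNorm p w ((opL u)^[k] g) ≤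
      ENNReal.ofReal (K ^ k) * lorentzNorm p w g := by
    intro k
    induction k with
    | zero => simp
    | succ k ih =>
      rw [Function.iterate_succ_apply']
      refine (hL _ (aemeasurable_iterate_opL hu hg k)).trans ?_
      rw [pow_succ', ENNReal.ofReal_mul hK.le, mul_assoc]
      gcongr
  -- The `k`-th term of `R` has norm at most `12 ^ (-k)` times that of `g`; splitting the level with
  -- these weights costs `(4 / 3) * 4 ^ k`, and `∑ (4 / 3) * 3 ^ (-k) = 2`. This is why `K` is
  -- multiplied by `6`.
  have hgeom : HasSum (fun k : ℕ => (3 / 4 : ℝ) * (1 / 4) ^ k) 1 := by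
    have := (hasSum_geometric_of_lt_one (r := (1 / 4 : ℝ)) (by norm_num) (by norm_num)).mul_left
      (3 / 4 : ℝ)
    norm_num at this ⊢
    exact this
  have hgeom' : HasSum (fun k : ℕ => (4 / 3 : ℝ) * (1 / 3) ^ k) 2 := by
    have := (hasSum_geometric_of_lt_one (r := (1 / 3 : ℝ)) (by norm_num) (by norm_num)).mul_left
      (4 / 3 : ℝ)
    norm_num at this ⊢
    exact this
  have hmain := lorentzNorm_tsum_le w
    (fun k x => (opL u)^[k] g x / ENNReal.ofReal (2 ^ k * (6 * K) ^ k)) hp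
    (fun k => by positivity) hgeom
  refine hmain.trans ?_
  calc ∑' k : ℕ, ENNReal.ofReal ((3 / 4 : ℝ) * (1 / 4) ^ k)⁻¹ *
        lorentzNorm p w (fun x => (opL u)^[k] g x / ENNReal.ofReal (2 ^ k * (6 * K) ^ k))
      ≤ ∑' k : ℕ, ENNReal.ofReal ((4 / 3 : ℝ) * (1 / 3) ^ k) * lorentzNorm p w g := by
        refine ENNReal.tsum_le_tsum fun k => ?_
        rw [lorentzNorm_div_ofReal w _ p (by positivity)]
        calc ENNReal.ofReal ((3 / 4 : ℝ) * (1 / 4) ^ k)⁻¹ *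
              (ENNReal.ofReal (2 ^ k * (6 * K) ^ k)⁻¹ * lorentzNorm p w ((opL u)^[k] g))
            ≤ ENNReal.ofReal ((3 / 4 : ℝ) * (1 / 4) ^ k)⁻¹ *
              (ENNReal.ofReal (2 ^ k * (6 * K) ^ k)⁻¹ *
                (ENNReal.ofReal (K ^ k) * lorentzNorm p w g)) := by
              gcongr
              exact hiter k
          _ = _ := by
              rw [← mul_assoc, ← mul_assoc, ← ENNReal.ofReal_mul (by positivity),
                ← ENNReal.ofReal_mul (by positivity)]
              congr 2
              rw [← mul_pow, show 2 * (6 * K) = 3 * 4 * K by ring, mul_pow, mul_pow, one_div,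
                inv_pow, one_div, inv_pow]
              field_simp
    _ = 2 * lorentzNorm p w g := by
        rw [ENNReal.tsum_mul_right, ← ENNReal.ofReal_tsum_of_nonneg (fun k => by positivity)
          hgeom'.summable, hgeom'.tsum_eq, ENNReal.ofReal_ofNat]

/-- As `M (u L^k g) = u L^(k+1) g`, applying `M` termwise shifts the series by one index, and the
shift costs exactly `2 K`. -/
lemma maximal_mul_opR_le {u g : (Fin n → ℝ) → ℝ≥0∞} {K : ℝ} (hu : IsWeight u) (hK : 0 < K)
    (hg : AEMeasurable g) :
    ∀ᵐ x, maximal (fun y => u y * opR u K g y) x ≤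
      ENNReal.ofReal (2 * K) * (u x * opR u K g x) := by
  filter_upwards [hu.pos, hu.ae_lt_top] with x h0 ht
  have hterm : ∀ k : ℕ, maximal (fun y => (ENNReal.ofReal (2 ^ k * K ^ k))⁻¹ *
      (u y * (opL u)^[k] g y)) x ≤ ENNReal.ofReal (2 * K) *
        (u x * ((opL u)^[k + 1] g x / ENNReal.ofReal (2 ^ (k + 1) * K ^ (k + 1)))) := by
    intro k
    have hpos : 0 < 2 ^ k * K ^ k := by positivity
    have hinv : (ENNReal.ofReal (2 ^ k * K ^ k))⁻¹ ≠ ∞ := by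
      simpa using hpos
    refine (maximal_const_mul_le hinv _ x).trans (le_of_eq ?_)
    have hL : u x * (opL u)^[k + 1] g x = maximal (fun y => u y * (opL u)^[k] g y) x := by
      rw [Function.iterate_succ_apply', opL, ENNReal.mul_div_cancel h0.ne' ht.ne]
    rw [← mul_div_assoc, hL, div_eq_mul_inv, mul_comm (maximal _ x), ← mul_assoc,
      ← ENNReal.ofReal_inv_of_pos hpos, ← ENNReal.ofReal_inv_of_pos (by positivity),
      ← ENNReal.ofReal_mul (by positivity)]
    congr 2
    field_simp
    ring
  calc maximal (fun y => u y * opR u K g y) x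
      = maximal (fun y => ∑' k : ℕ, (ENNReal.ofReal (2 ^ k * K ^ k))⁻¹ *
          (u y * (opL u)^[k] g y)) x := by
        congr 1
        ext y
        rw [opR, ← ENNReal.tsum_mul_left]
        refine tsum_congr fun k => ?_
        rw [div_eq_mul_inv]
        ring
    _ ≤ ∑' k : ℕ, maximal (fun y => (ENNReal.ofReal (2 ^ k * K ^ k))⁻¹ *
          (u y * (opL u)^[k] g y)) x :=
        maximal_tsum_le (fun k => (hu.aemeasurable.mul
          (aemeasurable_iterate_opL hu.aemeasurable hg k)).const_mul _) x
    _ ≤ ∑' k : ℕ, ENNReal.ofReal (2 * K) *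
        (u x * ((opL u)^[k + 1] g x / ENNReal.ofReal (2 ^ (k + 1) * K ^ (k + 1)))) :=
        ENNReal.tsum_le_tsum hterm
    _ ≤ ENNReal.ofReal (2 * K) * (u x * opR u K g x) := by
        rw [ENNReal.tsum_mul_left, ENNReal.tsum_mul_left, opR]
        gcongr _ * (_ * ?_)
        exact ENNReal.tsum_comp_le_tsum_of_injective (add_left_injective 1) _

lemma isA1_mul_opR {u g : (Fin n → ℝ) → ℝ≥0∞} {K : ℝ} (hu : IsWeight u) (hK : 0 < K)
    (hg : AEMeasurable g) (hg0 : ¬ g =ᵐ[volume] 0) (hfin : ∀ᵐ x, opR u K g x < ∞) :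
    IsA1 (fun x => u x * opR u K g x) ∧
      a1Const (fun x => u x * opR u K g x) ≤ ENNReal.ofReal (2 * K) := by
  have hM := maximal_mul_opR_le hu hK hg
  have hconst : a1Const (fun x => u x * opR u K g x) ≤ ENNReal.ofReal (2 * K) := sInf_le hM
  refine ⟨⟨⟨?_, ?_, ?_⟩, hconst.trans_lt ENNReal.ofReal_lt_top⟩, hconst⟩
  · refine hu.aemeasurable.mul ?_
    unfold opR
    exact AEMeasurable.tsum fun k =>
      (aemeasurable_iterate_opL hu.aemeasurable hg k).div_const _
  · have hug : ¬ (fun y => u y * g y) =ᵐ[volume] 0 := by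
      intro h
      apply hg0
      filter_upwards [h, hu.pos] with x hx h0
      simpa [h0.ne'] using hx
    filter_upwards [hu.pos, hu.ae_lt_top] with x h0 ht
    refine ENNReal.mul_pos h0.ne' ?_
    -- The term `k = 0` may vanish at `x`, but the term `k = 1` contains a maximal function, which
    -- is positive everywhere.
    have hpos : 0 < opL u g x / ENNReal.ofReal (2 ^ 1 * K ^ 1) := by
      refine ENNReal.div_pos (ENNReal.div_pos ?_ ht.ne).ne' ENNReal.ofReal_ne_top
      exact (maximal_pos (hu.aemeasurable.mul hg) hug x).ne'
    exact (hpos.trans_le (ENNReal.le_tsum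
      (f := fun k => (opL u)^[k] g x / ENNReal.ofReal (2 ^ k * K ^ k)) 1)).ne'
  · intro S hS
    -- Finiteness of the maximal function at a single point already forces local integrability.
    obtain ⟨x, hx, hxt, hux⟩ := (hM.and (hfin.and hu.ae_lt_top)).exists
    have hMx : maximal (fun y => u y * opR u K g y) x < ∞ :=
      hx.trans_lt (ENNReal.mul_lt_top ENNReal.ofReal_lt_top (ENNReal.mul_lt_top hux hxt))
    obtain ⟨R, hR⟩ := hS.isBounded.subset_closedBall x
    have hR' : S ⊆ Metric.closedBall x (max R 1) :=
      hR.trans (Metric.closedBall_subset_closedBall (le_max_left _ _))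
    have hpos : 0 < max R 1 := lt_max_of_lt_right one_pos
    refine (lintegral_mono_set hR').trans_lt ((setLIntegral_cube_le _ hpos
      (Metric.mem_closedBall_self hpos.le)).trans_lt ?_)
    exact ENNReal.mul_lt_top hMx (volume_cube_ne_top _ _).lt_top

lemma IsA1.one_le_a1Const {u : (Fin n → ℝ) → ℝ≥0∞} (hu : IsA1 u) : 1 ≤ (a1Const u).toReal := by
  have h : 1 ≤ a1Const u := le_sInf fun _ hC => hu.1.one_le_of_maximal_le hC
  simpa using ENNReal.toReal_mono hu.2.ne h

/-- The factor `2` avoids showing that the infimum is attained; it is absorbed in the final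
constants. -/
lemma IsA1.maximal_le {u : (Fin n → ℝ) → ℝ≥0∞} (hu : IsA1 u) :
    ∀ᵐ x, maximal u x ≤ ENNReal.ofReal (2 * (a1Const u).toReal) * u x := by
  have h1 := hu.one_le_a1Const
  have hlt : a1Const u < ENNReal.ofReal (2 * (a1Const u).toReal) := by
    nth_rw 1 [← ENNReal.ofReal_toReal hu.2.ne]
    exact (ENNReal.ofReal_lt_ofReal_iff (by linarith)).2 (by linarith)
  obtain ⟨C, hC, hClt⟩ := sInf_lt_iff.1 hlt
  filter_upwards [hC] with x hx
  exact hx.trans (by gcongr)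

/-! ### Products of negative powers of maximal functions -/

section MaximalProduct

variable {N : ℕ} {h : Fin N → (Fin n → ℝ) → ℝ} {α : Fin N → ℝ} {s : ℝ}

lemma measurable_maximalProduct_rpow (h : Fin N → (Fin n → ℝ) → ℝ) (α : Fin N → ℝ) (s : ℝ) :
    Measurable fun x => maximalProduct h α x ^ s :=
  (Finset.measurable_fun_prod _ fun _ _ => (measurable_maximal _).pow_const _).pow_const _

lemma maximalProduct_rpow_ne_top (hα : ∀ j, 0 < α j) (hs : 0 ≤ s) {x : Fin n → ℝ}
    (hpos : ∀ j, 0 < maximal (fun y => ‖h j y‖ₑ) x) : maximalProduct h α x ^ s ≠ ∞ := by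
  refine ENNReal.rpow_ne_top_of_nonneg hs (ENNReal.prod_ne_top fun j _ => ?_)
  simp [ENNReal.rpow_eq_top_iff, (hpos j).ne', (hα j).le]

lemma maximalProduct_rpow_ne_zero (hα : ∀ j, 0 < α j) (hs : 0 ≤ s) {x : Fin n → ℝ}
    (hfin : ∀ j, maximal (fun y => ‖h j y‖ₑ) x < ∞) : maximalProduct h α x ^ s ≠ 0 := by
  have hprod : maximalProduct h α x ≠ 0 := by
    refine Finset.prod_ne_zero_iff.2 fun j _ => ?_
    simp [ENNReal.rpow_eq_zero_iff, (hfin j).ne, (hα j).le]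
  simp [ENNReal.rpow_eq_zero_iff, hprod, hs]

lemma maximalProduct_rpow_rpow (hα : ∀ j, 0 < α j) {x : Fin n → ℝ}
    (hpos : ∀ j, 0 < maximal (fun y => ‖h j y‖ₑ) x) (e : ℝ) :
    (maximalProduct h α x ^ s) ^ (-1 / e) =
      ∏ j, maximal (fun y => ‖h j y‖ₑ) x ^ (α j * s / e) := by
  rw [maximalProduct, ← ENNReal.rpow_mul, ← ENNReal.prod_rpow_of_ne_top]
  · refine Finset.prod_congr rfl fun j _ => ?_
    rw [← ENNReal.rpow_mul]
    congr 1
    ring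
  · intro j _
    simp [ENNReal.rpow_eq_top_iff, (hpos j).ne', (hα j).le]

end MaximalProduct

end RestrictedWeights

/-! ### Choice of the exponents and constants -/

open RestrictedWeights in
theorem proposition2p4 (n : ℕ) (hn : 1 ≤ n) (N : ℕ) (α : Fin N → ℝ) (hα : ∀ j, 0 < α j)
    (s : ℝ) (hs : 1 ≤ s) :
    ∃ c C : ℝ, 0 < c ∧ 0 < C ∧
      ∀ (u₀ : (Fin n → ℝ) → ℝ≥0∞) (h : Fin N → (Fin n → ℝ) → ℝ), IsA1 u₀ →
        (∀ j, LocallyIntegrable (h j)) → (∀ j, ¬ h j =ᵐ[volume] 0) →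
        (∀ j, ∀ᵐ x, maximal (fun y => ‖h j y‖ₑ) x < ∞) →
        ∃ p₀ K₀ : ℝ, 1 < p₀ ∧ 0 < K₀ ∧
          c * (a1Const u₀).toReal ≤ p₀ ∧ p₀ ≤ C * (a1Const u₀).toReal ∧
          c * (a1Const u₀).toReal ^ 2 ≤ K₀ ∧ K₀ ≤ C * (a1Const u₀).toReal ^ 2 ∧
          -- `L` is bounded on `L^{p,1}(u₀ ν^s)` with norm at most `K₀`, for every `p ≥ p₀`
          (∀ p : ℝ, p₀ ≤ p → ∀ f : (Fin n → ℝ) → ℝ≥0∞, AEMeasurable f →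
            lorentzNorm p (fun x => u₀ x * maximalProduct h α x ^ s) (opL u₀ f) ≤
              ENNReal.ofReal K₀ *
                lorentzNorm p (fun x => u₀ x * maximalProduct h α x ^ s) f) ∧
          -- (1)
          (∀ g : (Fin n → ℝ) → ℝ≥0∞, ∀ x, g x ≤ opR u₀ K₀ g x) ∧
          -- (2)
          (∀ p : ℝ, p₀ ≤ p → ∀ g : (Fin n → ℝ) → ℝ≥0∞, AEMeasurable g →
            ¬ g =ᵐ[volume] 0 →
            lorentzNorm p (fun x => u₀ x * maximalProduct h α x ^ s) g < ∞ →
            IsA1 (fun x => u₀ x * opR u₀ K₀ g x) ∧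
              a1Const (fun x => u₀ x * opR u₀ K₀ g x) ≤ ENNReal.ofReal (2 * K₀)) ∧
          -- (3)
          (∀ p : ℝ, p₀ ≤ p → ∀ g : (Fin n → ℝ) → ℝ≥0∞, AEMeasurable g →
            lorentzNorm p (fun x => u₀ x * maximalProduct h α x ^ s) (opR u₀ K₀ g) ≤
              2 * lorentzNorm p (fun x => u₀ x * maximalProduct h α x ^ s) g) := by
  obtain ⟨δ₀, C₀, hδ₀, hC₀, hprod⟩ := exists_setLIntegral_prod_maximal_rpow_le n
  have hs0 : 0 < s := by linarith
  -- With `q - 1 = A * Λ`, the exponents `α j * s / (q - 1)` meet the smallness condition `N * γ j ≤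
  -- δ₀ / A`; the `+ 1` keeps `q > 1` when `N = 0`.
  set Λ : ℝ := N * (∑ j, α j * s) / δ₀ + 1 with hΛ
  have hsum0 : 0 ≤ ∑ j, α j * s := Finset.sum_nonneg fun j _ => (mul_pos (hα j) hs0).le
  have hΛ1 : 1 ≤ Λ := by
    rw [hΛ, le_add_iff_nonneg_left]
    positivity
  set B : ℝ := C₀ * 5 ^ n with hB
  have hB1 : 1 ≤ B := one_le_mul_of_one_le_of_one_le hC₀ (one_le_pow₀ (by norm_num))
  -- In terms of `a = [u]_{A₁}`, the final choices are `p₀ = 4 q = 4 + 8 Λ a` and `K₀ = 48 B A² =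
  -- 192 B a²`.
  refine ⟨1, 4 + 8 * Λ + 192 * B, one_pos, by positivity, ?_⟩
  intro u h hu hloc hne hfin
  set a : ℝ := (a1Const u).toReal with ha
  have ha1 : 1 ≤ a := hu.one_le_a1Const
  set A : ℝ := 2 * a with hAdef
  have hA1 : 1 ≤ A := by linarith
  have hA : ∀ᵐ x, maximal u x ≤ ENNReal.ofReal A * u x := hu.maximal_le
  have hw : IsWeight u := hu.1
  set q : ℝ := 1 + A * Λ with hq
  have hAΛ : 1 ≤ A * Λ := one_le_mul_of_one_le_of_one_le hA1 hΛ1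
  have hq1 : 1 < q := by linarith
  have hpos : ∀ j x, 0 < maximal (fun y => ‖h j y‖ₑ) x := by
    intro j x
    refine maximal_pos (hloc j).aestronglyMeasurable.enorm (fun h0 => hne j ?_) x
    filter_upwards [h0] with y hy
    simpa using hy
  set ν : (Fin n → ℝ) → ℝ≥0∞ := fun x => maximalProduct h α x ^ s with hν
  have hνm : Measurable ν := measurable_maximalProduct_rpow h α s
  have hνt : ∀ x, ν x ≠ ∞ := fun x => maximalProduct_rpow_ne_top hα hs0.le fun j => hpos j x
  have hν0 : ∀ᵐ x, ν x ≠ 0 := by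
    filter_upwards [ae_all_iff.2 hfin] with x hx
    exact maximalProduct_rpow_ne_zero hα hs0.le hx
  have hγ : ∀ j, N * (α j * s / (q - 1)) ≤ δ₀ / A := by
    intro j
    have hj : α j * s ≤ ∑ j, α j * s :=
      Finset.single_le_sum (f := fun j => α j * s) (fun i _ => (mul_pos (hα i) hs0).le)
        (Finset.mem_univ j)
    have hle : N * (α j * s) ≤ δ₀ * Λ := by
      rw [hΛ, mul_add, mul_div_cancel₀ _ hδ₀.ne']
      have : N * (α j * s) ≤ N * ∑ j, α j * s := by gcongr
      linarith
    rw [hq, add_sub_cancel_left, ← mul_div_assoc,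
      div_le_div_iff₀ (by positivity) (by positivity)]
    nlinarith
  have hνK : ∀ (c z : Fin n → ℝ) (r : ℝ), 0 < r → z ∈ Metric.closedBall c r →
      ∫⁻ y in Metric.closedBall c r, ν y ^ (-1 / (q - 1)) ∂(volume.withDensity u) ≤
        ENNReal.ofReal (C₀ * A ^ 2) * ν z ^ (-1 / (q - 1)) *
          volume.withDensity u (Metric.closedBall c r) := by
    intro c z r hr hz
    simp only [hν, maximalProduct_rpow_rpow hα (fun j => hpos j _)]
    exact hprod u A hw hA1 hA N _ _ (fun j => div_pos (mul_pos (hα j) hs0) (by linarith)) hγ hpos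
      c z r hr hz
  have hY1 : 1 ≤ B * A := one_le_mul_of_one_le_of_one_le hB1 hA1
  have hL : ∀ p : ℝ, 4 * q ≤ p → ∀ f : (Fin n → ℝ) → ℝ≥0∞, AEMeasurable f →
      lorentzNorm p (fun x => u x * ν x) (opL u f) ≤
        ENNReal.ofReal (8 * A * (B * A)) * lorentzNorm p (fun x => u x * ν x) f := by
    intro p hp f hf
    refine lorentzNorm_opL_le hw hA1 hA hY1 hq1.le hp (fun g t hg ht ht' => ?_) hf
    refine (weak_type_opL hw hA1 hA (one_le_mul_of_one_le_of_one_le hC₀ (one_le_pow₀ hA1)) hq1 hνm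
      hν0 (Eventually.of_forall hνt) hνK hg ht ht').trans ?_
    gcongr (ENNReal.ofReal ?_ / _) ^ _ * _
    -- The weak type constant is of order `A ^ 4`. Taking `Y = B * A` is more than enough to
    -- dominate it by `A * Y ^ 4`, and makes `A * Y` of order `A ^ 2`, as the two-sided bound on
    -- `K₀` requires.
    calc C₀ * A ^ 2 * A ^ 2 * 5 ^ n = B * A ^ 4 := by rw [hB]; ring
      _ ≤ B ^ 4 * A ^ 5 :=
          mul_le_mul (le_self_pow₀ hB1 (by norm_num)) (pow_le_pow_right₀ hA1 (by norm_num))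
            (by positivity) (by positivity)
      _ = A * (B * A) ^ 4 := by ring
  have hK : 0 < 8 * A * (B * A) := by positivity
  have hwm : AEMeasurable fun x => u x * ν x := hw.aemeasurable.mul hνm.aemeasurable
  have hw0 : ∀ᵐ x, u x * ν x ≠ 0 := by
    filter_upwards [hw.pos, hν0] with x h1 h2 using mul_ne_zero h1.ne' h2
  have hR : ∀ p : ℝ, 4 * q ≤ p → ∀ g : (Fin n → ℝ) → ℝ≥0∞, AEMeasurable g →
      lorentzNorm p (fun x => u x * ν x) (opR u (6 * (8 * A * (B * A))) g) ≤
        2 * lorentzNorm p (fun x => u x * ν x) g := fun p hp g hg =>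
    lorentzNorm_opR_le hw.aemeasurable (by linarith) hK (hL p hp) hg
  refine ⟨4 * q, 6 * (8 * A * (B * A)), by linarith, by positivity, ?_, ?_, ?_, ?_, ?_,
    le_opR u _, ?_, hR⟩
  · nlinarith
  · have : 0 ≤ 192 * B * a := by positivity
    rw [hq, hAdef]
    nlinarith
  · rw [hAdef]
    nlinarith [sq_nonneg a, mul_le_mul_of_nonneg_right hB1 (sq_nonneg a)]
  · rw [hAdef]
    have : 0 ≤ (4 + 8 * Λ) * a ^ 2 := by positivity
    nlinarith
  · intro p hp f hf
    refine (hL p hp f hf).trans ?_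
    gcongr ENNReal.ofReal ?_ * _
    linarith
  · intro p hp g hg hg0 hgt
    refine isA1_mul_opR hw (by positivity) hg hg0 ?_
    exact ae_lt_top_of_lorentzNorm_lt_top (p := p) (by linarith) hwm hw0
      ((hR p hp g hg).trans_lt (ENNReal.mul_lt_top ENNReal.ofNat_lt_top hgt))
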